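/- **Setting.** Write $\mathbb{R}_+=(0,\infty)$, so that $\partial\mathbb{R}^2_+$ is the union of the two closed half-axes. A curve is continuous and strictly increasing (decreasing) if it is the graph of a continuous strictly increasing (decreasing) function on an interval. Let $\Gamma\subset[0,1]^2$ be a continuous strictly decreasing curve with endpoints $(1,0)$ and $(0,1)$, and let $\Omega$ be the bounded component of $[0,\infty)^2\setminus\Gamma$. Let $\{\Gamma_i\}_{i\in\mathbb{Z}}$ be a locally finite family of pairwise disjoint continuous strictly increasing curves, each having one endpoint (belonging to the curve) on $\partial([0,\infty)^2\setminus\Omega)$ and the other endpoint at infinity. Let $\{\Omega_i\}_{i\in\mathbb{Z}}$ be the distinct connected components of $([0,\infty)^2\setminus\Omega)\setminus\bigcup_i\Gamma_i$, labelled so that $\Gamma_i$ lies on the boundary of exactly the two components $\Omega_i$ and $\Omega_{i-1}$. Let $\mu,\sigma:[0,\infty)^2\to[0,\infty)$ and $\mu_s:\partial\mathbb{R}^2_+\to[0,\infty)$. Assume: * **(F1)** each $g\in\{\mu,\sigma^2\}$ is bounded and upper semicontinuous, $g=0$ on $\Omega$, and there is a constant $C_{lip}$ such that $g|_{\Omega_i}$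 is Lipschitz with constant $C_{lip}$ for every $i\in\mathbb{Z}$; * **(F3), simultaneously for $\mu$ and $\sigma^2$:** for every $i\in\mathbb{Z}$ and $x\in\Gamma_i$ there are $\varepsilon>0$ and $\zeta\in\{-1,+1\}$ such that for all $y\in B_\varepsilon(x)\cap\Gamma_i$ and for both $g=\mu$ and $g=\sigma^2$ $$\zeta\Big(\lim_{\Omega_{i-1}\ni z\to y}g(z)-\lim_{\Omega_i\ni z\to y}g(z)\Big)\ge 0;$$ * **(values on the curves)** for $g=\mu$ and $g=\sigma^2$, all $i\in\mathbb{Z}$ and all $y\in\Gamma_i$, $g(y)=\max\{\lim_{\Omega_{i-1}\ni z\to y}g(z),\ \lim_{\Omega_i\ni z\to y}g(z)\}$; * **(zero sets)** $\{x\in\mathbb{R}^2_+:\sigma(x)=0\}\subset\{x\in\mathbb{R}^2_+:\mu(x)=0\}$; * **(F2)** $\mu_s$ is bounded and upper semicontinuous with a locally finite set of discontinuities. Put $H(x,p)=(p_1-\mu(x))_+(p_2-\mu(x))_+-\sigma^2(x)$ and $\varphi(x)=(x_1+x_2)\int_0^1\big(\mu(tx)+\mu_s(tx)\big)\,dt$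 for $x\in\partial\mathbb{R}^2_+$, and consider $$\text{(P)}\qquad (U_{x_1}-\mu)_+(U_{x_2}-\mu)_+=\sigma^2\ \text{ on }\mathbb{R}^2_+,\qquad U=\varphi\ \text{ on }\partial\mathbb{R}^2_+ .$$ A function $u$ that is upper (lower) semicontinuous on $\mathbb{R}^2_+$ is a viscosity subsolution (supersolution) of $H(x,Du)=0$ on $\mathbb{R}^2_+$ if for all $x\in\mathbb{R}^2_+$ and all $p$ in the superdifferential $D^+u(x)$ (subdifferential $D^-u(x)$) one has $H_*(x,p)\le 0$ ($H^*(x,p)\ge 0$), where $H_*$ and $H^*$ are the lower and upper semicontinuous envelopes of $H$ in the variable $x$; a viscosity solution is both. Monotone means non-decreasing in each variable. **Theorem.** Let $u\in C([0,\infty)^2)$ be a viscosity subsolution and $v\in C([0,\infty)^2)$ a monotone viscosity supersolution of $H(x,Du)=0$ on $\mathbb{R}^2_+$. If $u\le\varphi\le v$ on $\partial\mathbb{R}^2_+$, then $u\le v$ on $[0,\infty)^2$. Consequently, (P) has at most one monotone viscosity solution in $C([0,\infty)^2)$. -/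

import Mathlib

open Set Filter Topology
open scoped NNReal

namespace DLPP

/-- The Euclidean plane. The coordinates `x₁`, `x₂` of a point `x` are `x 0`, `x 1`. -/
abbrev Plane : Type := EuclideanSpace ℝ (Fin 2)

/-- The closed quadrant `[0,∞)²`. -/
def quadrant : Set Plane := {x | 0 ≤ x 0 ∧ 0 ≤ x 1}

/-- The open quadrant `ℝ₊² = (0,∞)²`. -/
def openQuadrant : Set Plane := {x | 0 < x 0 ∧ 0 < x 1}

/-- The boundary of the quadrant, i.e. the union of the two half-axes. -/
def axes : Set Plane := {x | x ∈ quadrant ∧ (x 0 = 0 ∨ x 1 = 0)}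

/-- Monotone on the closed quadrant: non-decreasing with respect to all variables. -/
def IsMonotone (v : Plane → ℝ) : Prop :=
  ∀ x ∈ quadrant, ∀ y ∈ quadrant, x 0 ≤ y 0 → x 1 ≤ y 1 → v x ≤ v y

/-! ### Viscosity solutions of `H(x, Du) = 0` -/

/-- The superdifferential `D⁺u(x)` relative to `O`: all `p` with
`u(y) ≤ u(x) + ⟨p, y - x⟩ + o(|x - y|)` as `O ∋ y → x`. -/
def superdifferential (O : Set Plane) (u : Plane → ℝ) (x : Plane) : Set Plane :=
  {p | ∀ ε > 0, ∀ᶠ y in 𝓝[O] x, u y ≤ u x + inner ℝ p (y - x) + ε * ‖y - x‖}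

/-- The subdifferential `D⁻u(x)` relative to `O`: all `p` with
`u(y) ≥ u(x) + ⟨p, y - x⟩ + o(|x - y|)` as `O ∋ y → x`. -/
def subdifferential (O : Set Plane) (u : Plane → ℝ) (x : Plane) : Set Plane :=
  {p | ∀ ε > 0, ∀ᶠ y in 𝓝[O] x, u x + inner ℝ p (y - x) - ε * ‖y - x‖ ≤ u y}

/-- The lower semicontinuous envelope `H_*(x,p)` of `H` in the spatial variable
(for `x ∈ O` the filter `𝓝[O] x` includes the point `x` itself). -/
noncomputable def lowerEnvelope (O : Set Plane) (H : Plane → Plane → ℝ) (x p : Plane) : EReal :=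
  liminf (fun y => (H y p : EReal)) (𝓝[O] x)

/-- The upper semicontinuous envelope `H^*(x,p)` of `H` in the spatial variable. -/
noncomputable def upperEnvelope (O : Set Plane) (H : Plane → Plane → ℝ) (x p : Plane) : EReal :=
  limsup (fun y => (H y p : EReal)) (𝓝[O] x)

/-- `u` is a viscosity subsolution of `H(x,Du) = 0` on `O`. -/
def IsViscositySubsolution (O : Set Plane) (H : Plane → Plane → ℝ) (u : Plane → ℝ) : Prop :=
  UpperSemicontinuousOn u O ∧
    ∀ x ∈ O, ∀ p ∈ superdifferential O u x, lowerEnvelope O H x p ≤ 0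

/-- `u` is a viscosity supersolution of `H(x,Du) = 0` on `O`. -/
def IsViscositySupersolution (O : Set Plane) (H : Plane → Plane → ℝ) (u : Plane → ℝ) : Prop :=
  LowerSemicontinuousOn u O ∧
    ∀ x ∈ O, ∀ p ∈ subdifferential O u x, 0 ≤ upperEnvelope O H x p

/-! ### Geometry of the discontinuities -/

/-- `C` is a connected component of `S`. -/
def IsComponent (S C : Set Plane) : Prop := ∃ x ∈ S, C = connectedComponentIn S x

/-- The graph `{(t, f t) : t ∈ I}`. -/
def graphCurve (I : Set ℝ) (f : ℝ → ℝ) : Set Plane := (fun t => !₂[t, f t]) '' I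

/-- The curves `Γ`, `Γ_i` and the regions `Ω`, `Ω_i`. -/
structure CurveSystem where
  /-- the strictly decreasing curve `Γ` -/
  Gam : Set Plane
  /-- the region `Ω` cut off by `Γ` -/
  Om : Set Plane
  /-- the strictly increasing curves `Γ_i` -/
  Gams : ℤ → Set Plane
  /-- the regions `Ω_i` -/
  Oms : ℤ → Set Plane
  /-- `Γ` is a continuous strictly decreasing curve in `[0,1]²` from `(0,1)` to `(1,0)` -/
  gam_curve : ∃ f : ℝ → ℝ, ContinuousOn f (Icc 0 1) ∧ StrictAntiOn f (Icc 0 1) ∧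
    f 0 = 1 ∧ f 1 = 0 ∧ Gam = graphCurve (Icc 0 1) f
  /-- `Ω` is the bounded component of the complement of `Γ` in `[0,∞)²` -/
  om_component : IsComponent (quadrant \ Gam) Om
  om_bounded : Bornology.IsBounded Om
  /-- each `Γ_i` is a continuous strictly increasing curve in `[0,∞)²`, with one endpoint on the
  boundary of `[0,∞)² \ Ω` and the other endpoint at infinity -/
  gams_curve : ∀ i, ∃ (I : Set ℝ) (f : ℝ → ℝ) (a : ℝ), I.OrdConnected ∧
    ContinuousOn f I ∧ StrictMonoOn f I ∧ Gams i = graphCurve I f ∧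
    IsLeast I a ∧ !₂[a, f a] ∈ frontier (quadrant \ Om) ∧ ¬ Bornology.IsBounded (Gams i)
  gams_disjoint : ∀ i j, i ≠ j → Disjoint (Gams i) (Gams j)
  gams_locallyFinite : LocallyFinite Gams
  /-- the `Ω_i` are exactly the components of the complement of `⋃ Γ_i` in `[0,∞)² \ Ω` -/
  oms_component : ∀ C, IsComponent ((quadrant \ Om) \ ⋃ i, Gams i) C ↔ ∃ i, C = Oms i
  oms_injective : Function.Injective Oms
  /-- `Γ_i` is on the boundary of exactly two components, `Ω_i` and `Ω_{i-1}` -/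
  gams_frontier : ∀ i j, Gams i ⊆ frontier (Oms j) ↔ j = i ∨ j = i - 1

/-! ### Hypotheses on the coefficients -/

/-- (F1): `g : [0,∞)² → [0,∞)` is bounded and upper semicontinuous, vanishes on `Ω`, and is
Lipschitz on every `Ω_i` with a common constant. -/
structure HypF1 (G : CurveSystem) (g : Plane → ℝ) : Prop where
  nonneg : ∀ x ∈ quadrant, 0 ≤ g x
  bounded : ∃ M : ℝ, ∀ x ∈ quadrant, g x ≤ M
  usc : UpperSemicontinuousOn g quadrant
  zero_on : ∀ x ∈ G.Om, g x = 0
  lipschitz : ∃ C : ℝ≥0, ∀ i, LipschitzOnWith C g (G.Oms i)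

/-- (F2): `s : ∂ℝ₊² → [0,∞)` is bounded and upper semicontinuous with a locally finite set of
discontinuities. -/
structure HypF2 (s : Plane → ℝ) : Prop where
  nonneg : ∀ x ∈ axes, 0 ≤ s x
  bounded : ∃ M : ℝ, ∀ x ∈ axes, s x ≤ M
  usc : UpperSemicontinuousOn s axes
  discont : ∀ x, ∃ U ∈ 𝓝 x, ({y ∈ axes | ¬ ContinuousWithinAt s axes y} ∩ U).Finite

/-- The condition of (F3) at the point `y ∈ Γ_i` with the sign `ζ`:
`ζ (lim_{Ω_{i-1} ∋ z → y} g(z) - lim_{Ω_i ∋ z → y} g(z)) ≥ 0`. -/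
def JumpSign (G : CurveSystem) (g : Plane → ℝ) (i : ℤ) (ζ : ℝ) (y : Plane) : Prop :=
  ∃ a b : ℝ, Tendsto g (𝓝[G.Oms (i - 1)] y) (𝓝 a) ∧ Tendsto g (𝓝[G.Oms i] y) (𝓝 b) ∧
    0 ≤ ζ * (a - b)

/-- `g` and `h` satisfy (F3) simultaneously, i.e. with the same choice of `ζ`. -/
def SimultaneousF3 (G : CurveSystem) (g h : Plane → ℝ) : Prop :=
  ∀ i, ∀ x ∈ G.Gams i, ∃ ε > 0, ∃ ζ : ℝ, (ζ = -1 ∨ ζ = 1) ∧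
    ∀ y ∈ Metric.ball x ε ∩ G.Gams i, JumpSign G g i ζ y ∧ JumpSign G h i ζ y

/-- On each `Γ_i` the value of `g` is the larger of its limits from the two sides, i.e. the
smallest value which upper semicontinuity allows. -/
def LargerLimitOnCurves (G : CurveSystem) (g : Plane → ℝ) : Prop :=
  ∀ i, ∀ y ∈ G.Gams i, ∀ a b : ℝ, Tendsto g (𝓝[G.Oms (i - 1)] y) (𝓝 a) →
    Tendsto g (𝓝[G.Oms i] y) (𝓝 b) → g y = max a b

/-! ### The problem (P) -/

/-- `H(x,p) = (p₁ - μ(x))₊ (p₂ - μ(x))₊ - σ(x)²`. -/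
def hamiltonian (μ σ : Plane → ℝ) (x p : Plane) : ℝ :=
  max (p 0 - μ x) 0 * max (p 1 - μ x) 0 - σ x ^ 2

/-- The boundary data `φ(x) = (x₁ + x₂) ∫₀¹ μ(tx) + μ_s(tx) dt`, for `x ∈ ∂ℝ₊²`. -/
noncomputable def boundaryData (μ μs : Plane → ℝ) (x : Plane) : ℝ :=
  (x 0 + x 1) * ∫ t in (0 : ℝ)..1, (μ (t • x) + μs (t • x))

/-- `U` is a (continuous) monotone viscosity solution of (P). -/
structure IsMonotoneSolution (μ σ μs U : Plane → ℝ) : Prop where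
  continuousOn : ContinuousOn U quadrant
  monotone : IsMonotone U
  sub : IsViscositySubsolution openQuadrant (hamiltonian μ σ) U
  super : IsViscositySupersolution openQuadrant (hamiltonian μ σ) U
  boundary : ∀ x ∈ axes, U x = boundaryData μ μs x

end DLPP

/-!
The comparison `u ≤ v` rests on three observations.

*Strictness and localization.* Let `ψ` be `ε (x₁ + x₂)` plus a penalty that is convex and
non-decreasing in each variable and large on the upper and right sides of a box. Adding `ψ` moves
every subgradient of `v` up by at least `ε` in both components. Since the Hamiltonian is
non-decreasing in `p`, `v + ψ` is a strict supersolution, so a positive maximum of `u - v - ψ` over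
the box would be attained at an interior point (`le_on_box`), and it suffices to exclude such
maxima (`not_isLocalMax_sub`).

*Shifted doubling of variables.* At a point of an increasing curve `Γ_i` both `μ` and `σ²` have
their smaller limits from the same side, and the diagonal direction `e = (-1, 1)` or `(1, -1)`
pointing into that side is transversal to `Γ_i`. Doubling variables with the penalty
`‖(x - y) / δ - e‖²`, which needs only the continuity of `u` and `v`, produces contact points with
`(x - y) / δ` close to `e` (`exists_shifted_doubling_max`). The coefficients at `x` then exceed
those at `y` by at most an arbitrarily small amount, and the strictness contradicts the two viscosity
inequalities. If `σ` degenerates at `y`, the inequality for `v` at `y` is void, and one needs in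
addition that subgradients of `v` are bounded below by the nearby values of `μ`
(`le_apply_of_supersolution`); here the condition on the zero sets and the monotonicity of `v`
enter.

*The decreasing curve.* At the points where some `Γ_i` meets `Γ` there is in general no suitable
direction. This is avoided by treating `Ω` first: it is a union of boxes with corner at the origin,
on which the coefficients vanish, so `u ≤ v` on the closure of `Ω` (`le_on_om`), and maxima need
only be excluded off that closure. There a point either has a neighbourhood inside one `Ω_i`, or lies on
one `Γ_i`, which cuts a small square into two connected sides belonging to `Ω_i` and `Ω_{i-1}`
(`CurveSystem.exists_sides`).
-/

namespace DLPP

/-! ### Coordinates in the plane -/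

lemma isOpen_openQuadrant : IsOpen openQuadrant := by
  have h0 : Continuous fun x : Plane => x 0 := by fun_prop
  have h1 : Continuous fun x : Plane => x 1 := by fun_prop
  exact (isOpen_lt continuous_const h0).inter (isOpen_lt continuous_const h1)

lemma isClosed_quadrant : IsClosed quadrant := by
  have h0 : Continuous fun x : Plane => x 0 := by fun_prop
  have h1 : Continuous fun x : Plane => x 1 := by fun_prop
  exact (isClosed_le continuous_const h0).inter (isClosed_le continuous_const h1)

lemma openQuadrant_subset_quadrant : openQuadrant ⊆ quadrant := fun _ h => ⟨h.1.le, h.2.le⟩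

lemma quadrant_mem_nhds {x : Plane} (hx : x ∈ openQuadrant) : quadrant ∈ 𝓝 x :=
  mem_of_superset (isOpen_openQuadrant.mem_nhds hx) openQuadrant_subset_quadrant

lemma norm_sq_eq (d : Plane) {i j : Fin 2} (hij : i ≠ j) : ‖d‖ ^ 2 = d i ^ 2 + d j ^ 2 := by
  rw [EuclideanSpace.norm_sq_eq]
  fin_cases i <;> fin_cases j <;> simp_all [Fin.sum_univ_two, add_comm]

lemma inner_eq (p d : Plane) {i j : Fin 2} (hij : i ≠ j) :
    inner ℝ p d = p i * d i + p j * d j := by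
  fin_cases i <;> fin_cases j <;>
    simp_all [PiLp.inner_apply, Fin.sum_univ_two, mul_comm, add_comm]

lemma abs_apply_le_norm (d : Plane) (i : Fin 2) : |d i| ≤ ‖d‖ := by
  simpa using PiLp.norm_apply_le d i

lemma norm_le_abs_add_abs (d : Plane) {i j : Fin 2} (hij : i ≠ j) : ‖d‖ ≤ |d i| + |d j| := by
  refine abs_le_of_sq_le_sq' ?_ (by positivity) |>.2
  rw [norm_sq_eq d hij, ← sq_abs (d i), ← sq_abs (d j)]
  nlinarith [abs_nonneg (d i), abs_nonneg (d j)]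

/-- The unit vector along the `i`-th axis. -/
noncomputable abbrev axisVector (i : Fin 2) : Plane := EuclideanSpace.single i 1

lemma tendsto_sub_smul_axisVector (y : Plane) (i : Fin 2) :
    Tendsto (fun t : ℝ => y - t • axisVector i) (𝓝[>] 0) (𝓝 y) := by
  have h : Tendsto (fun t : ℝ => y - t • axisVector i) (𝓝 0)
      (𝓝 (y - (0 : ℝ) • axisVector i)) := by
    apply Continuous.tendsto; fun_prop
  rw [zero_smul, sub_zero] at h
  exact h.mono_left nhdsWithin_le_nhds

/-! ### Test functions and envelopes -/

/-- A one-sided second-order expansion already produces an element of the superdifferential. -/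
lemma mem_superdifferential_of_le {u : Plane → ℝ} {x p : Plane} {C : ℝ}
    (h : ∀ᶠ y in 𝓝 x, u y ≤ u x + inner ℝ p (y - x) + C * ‖y - x‖ ^ 2) :
    p ∈ superdifferential openQuadrant u x := by
  intro ε hε
  have hb : ∀ᶠ y in 𝓝 x, C * ‖y - x‖ < ε := by
    have : Tendsto (fun y => C * ‖y - x‖) (𝓝 x) (𝓝 (C * ‖x - x‖)) := by
      apply Continuous.tendsto; fun_prop
    exact this.eventually_lt_const (by simpa using hε)
  refine (h.and hb).filter_mono nhdsWithin_le_nhds |>.mono fun y hy => hy.1.trans ?_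
  nlinarith [hy.2, norm_nonneg (y - x)]

lemma mem_subdifferential_of_le {u : Plane → ℝ} {x p : Plane} {C : ℝ}
    (h : ∀ᶠ y in 𝓝 x, u x + inner ℝ p (y - x) - C * ‖y - x‖ ^ 2 ≤ u y) :
    p ∈ subdifferential openQuadrant u x := by
  intro ε hε
  have hb : ∀ᶠ y in 𝓝 x, C * ‖y - x‖ < ε := by
    have : Tendsto (fun y => C * ‖y - x‖) (𝓝 x) (𝓝 (C * ‖x - x‖)) := by
      apply Continuous.tendsto; fun_prop
    exact this.eventually_lt_const (by simpa using hε)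
  refine (h.and hb).filter_mono nhdsWithin_le_nhds |>.mono fun y hy => le_trans ?_ hy.1
  nlinarith [hy.2, norm_nonneg (y - x)]

lemma IsViscositySubsolution.frequently_lt {H : Plane → Plane → ℝ} {u : Plane → ℝ}
    (hu : IsViscositySubsolution openQuadrant H u) {x p : Plane} (hx : x ∈ openQuadrant)
    (hp : p ∈ superdifferential openQuadrant u x) {τ : ℝ} (hτ : 0 < τ) :
    ∃ᶠ y in 𝓝 x, H y p < τ := by
  have h := hu.2 x hx p hp
  unfold lowerEnvelope at h
  rw [isOpen_openQuadrant.nhdsWithin_eq hx] at h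
  have h' := frequently_lt_of_liminf_lt (by isBoundedDefault)
    (h.trans_lt (EReal.coe_pos.2 hτ))
  exact h'.mono fun y hy => EReal.coe_lt_coe_iff.1 hy

lemma IsViscositySupersolution.frequently_lt {H : Plane → Plane → ℝ} {v : Plane → ℝ}
    (hv : IsViscositySupersolution openQuadrant H v) {x p : Plane} (hx : x ∈ openQuadrant)
    (hp : p ∈ subdifferential openQuadrant v x) {τ : ℝ} (hτ : 0 < τ) :
    ∃ᶠ y in 𝓝 x, -τ < H y p := by
  have h := hv.2 x hx p hp
  unfold upperEnvelope at h
  rw [isOpen_openQuadrant.nhdsWithin_eq hx] at h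
  have h0 : ((-τ : ℝ) : EReal) < 0 := by exact_mod_cast neg_lt_zero.2 hτ
  have h' := frequently_lt_of_lt_limsup (by isBoundedDefault) (h0.trans_le h)
  exact h'.mono fun y hy => EReal.coe_lt_coe_iff.1 hy

/-- If `v` grows at rate at least `m` along the `i`-th axis up to `y`, then so do all test
functions touching `v` from below at `y`. -/
lemma le_apply_of_mem_subdifferential {v : Plane → ℝ} {y p : Plane} (hy : y ∈ openQuadrant)
    (hp : p ∈ subdifferential openQuadrant v y) (i : Fin 2) {m : ℝ}
    (h : ∀ᶠ t in 𝓝[>] (0 : ℝ), v (y - t • axisVector i) ≤ v y - m * t) : m ≤ p i := by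
  refine le_of_forall_pos_le_add fun ε hε => ?_
  have h1 := hp ε hε
  rw [isOpen_openQuadrant.nhdsWithin_eq hy] at h1
  obtain ⟨t, ⟨hA, hB⟩, hpos⟩ :=
    (((tendsto_sub_smul_axisVector y i).eventually h1).and h |>.and self_mem_nhdsWithin).exists
  have hpos' : 0 < t := hpos
  have hn : ‖y - t • axisVector i - y‖ = t := by
    simp [norm_smul, abs_of_pos hpos']
  have hi : inner ℝ p (y - t • axisVector i - y) = -(t * p i) := by
    simp [inner_neg_right, inner_smul_right, axisVector, EuclideanSpace.inner_single_right]
  rw [hn, hi] at hA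
  nlinarith

lemma subdifferential_nonneg {v : Plane → ℝ} (hv : IsMonotone v) {y p : Plane}
    (hy : y ∈ openQuadrant) (hp : p ∈ subdifferential openQuadrant v y) (i : Fin 2) :
    0 ≤ p i := by
  refine le_apply_of_mem_subdifferential hy hp i ?_
  filter_upwards [(tendsto_sub_smul_axisVector y i).eventually (quadrant_mem_nhds hy),
    self_mem_nhdsWithin] with t ht1 ht2
  have ht2' : 0 < t := ht2
  have hk : ∀ k, (y - t • axisVector i) k ≤ y k := by
    intro k
    rcases eq_or_ne i k with rfl | hk
    · simp [ht2'.le]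
    · simp [hk.symm]
  have := hv _ ht1 _ (openQuadrant_subset_quadrant hy) (hk 0) (hk 1)
  linarith

/-! ### Growth of supersolutions along the axes -/

/-- Upper quadratic expansion of `t ↦ max (t - R) 0 ^ 2`, whose derivative is `2`-Lipschitz. -/
lemma sq_max_sub_le (R s t : ℝ) :
    max (t - R) 0 ^ 2 ≤ max (s - R) 0 ^ 2 + 2 * max (s - R) 0 * (t - s) + (t - s) ^ 2 := by
  rcases le_total (t - R) 0 with ht | ht <;> rcases le_total (s - R) 0 with hs | hs <;>
    simp only [max_eq_left, max_eq_right, ht, hs] <;> nlinarith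

/-- If every subgradient of `v` on an open set has `i`-th component at least `m`, then `v` grows
at rate at least `m` along segments parallel to the `i`-th axis. Otherwise an interior minimum of
`v` minus a function of slope less than `m`, penalized away from the segment and beyond its upper
end, would produce a forbidden subgradient. -/
lemma add_mul_le_of_forall_subdifferential {S : Set Plane} (hSo : IsOpen S) {v : Plane → ℝ}
    (hv : ContinuousOn v S) {m : ℝ} {i : Fin 2}
    (hm : ∀ z ∈ S, ∀ p ∈ subdifferential openQuadrant v z, m ≤ p i) {x : Plane} {h h' : ℝ}
    (hh : 0 < h) (hh' : h < h') (hseg : ∀ t ∈ Icc 0 h', x + t • axisVector i ∈ S) :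
    v x + m * h ≤ v (x + h • axisVector i) := by
  by_contra! hlt
  obtain ⟨j, hij⟩ : ∃ j : Fin 2, i ≠ j := ⟨i + 1, by fin_cases i <;> simp⟩
  obtain ⟨m', hm'1, hm'⟩ : ∃ m', v (x + h • axisVector i) < v x + m' * h ∧ m' < m := by
    refine ⟨((v (x + h • axisVector i) - v x) / h + m) / 2, ?_, ?_⟩
    · have : (v (x + h • axisVector i) - v x) / h < m := by rw [div_lt_iff₀ hh]; linarith
      have h2 : (v (x + h • axisVector i) - v x) / h <
        ((v (x + h • axisVector i) - v x) / h + m) / 2 := by linarith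
      rw [div_lt_iff₀ hh] at h2
      linarith
    · have : (v (x + h • axisVector i) - v x) / h < m := by rw [div_lt_iff₀ hh]; linarith
      linarith
  set T := v (x + h • axisVector i) - m' * h with hT
  have hx : x ∈ S := by simpa using hseg 0 ⟨le_rfl, by linarith⟩
  -- a closed rectangle around the segment that stays in `S`
  have hKc : IsCompact ((fun t : ℝ => x + t • axisVector i) '' Icc 0 h') :=
    isCompact_Icc.image (by fun_prop)
  obtain ⟨r₁, hr₁, hr₁S⟩ := hKc.exists_cthickening_subset_open hSo
    (by rintro _ ⟨t, ht, rfl⟩; exact hseg t ht)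
  have hvx : ∀ᶠ z in 𝓝 x, T < v z :=
    ((hv.continuousAt (hSo.mem_nhds hx)).eventually_const_lt (by linarith))
  obtain ⟨r₂, hr₂, hr₂v⟩ := Metric.eventually_nhds_iff.1 hvx
  obtain ⟨r, hr, hrr₁, hrr₂⟩ : ∃ r > 0, r ≤ r₁ ∧ r < r₂ :=
    ⟨min r₁ (r₂ / 2), by positivity, min_le_left _ _, (min_le_right _ _).trans_lt (by linarith)⟩
  set Q : Set Plane := {z | (0 ≤ z i - x i ∧ z i - x i ≤ h') ∧ |z j - x j| ≤ r} with hQ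
  have hnorm : ∀ (z : Plane) (t : ℝ), z i - x i = t →
      ‖z - (x + t • axisVector i)‖ ≤ |z j - x j| := by
    intro z t ht
    refine (norm_le_abs_add_abs _ hij).trans ?_
    have : z i = x i + t := by linarith
    simp [hij.symm, this]
  have hQS : Q ⊆ S := fun z hz => hr₁S <| by
    refine Metric.mem_cthickening_of_dist_le z (x + (z i - x i) • axisVector i) _ _
      ⟨_, hz.1, rfl⟩ ?_
    rw [dist_eq_norm]
    exact (hnorm z _ rfl).trans (hz.2.trans hrr₁)
  have hQc : IsCompact Q := by
    refine Metric.isCompact_of_isClosed_isBounded ?_ ?_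
    · have c1 : Continuous fun z : Plane => z i - x i := by fun_prop
      have c2 : Continuous fun z : Plane => |z j - x j| := by fun_prop
      exact ((isClosed_le continuous_const c1).inter (isClosed_le c1 continuous_const)).inter
        (isClosed_le c2 continuous_const)
    · refine (Metric.isBounded_closedBall (x := x) (r := h' + r)).subset fun z hz => ?_
      rw [mem_closedBall_iff_norm]
      refine (norm_le_abs_add_abs _ hij).trans (add_le_add ?_ hz.2)
      rw [PiLp.sub_apply, abs_of_nonneg hz.1.1]
      exact hz.1.2
  obtain ⟨B, hB⟩ := hQc.exists_bound_of_continuousOn (hv.mono hQS)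
  set L := |T| + B + |m'| * h' + 1 with hL
  have hxQ : x + h • axisVector i ∈ Q := by
    simp [hQ, hh.le, hij.symm, hr.le]
    linarith
  have hBnn : 0 ≤ B := (norm_nonneg _).trans (hB _ hxQ)
  have hLpos : 0 < L := by
    have : 0 ≤ |m'| * h' := mul_nonneg (abs_nonneg _) (by linarith)
    have := abs_nonneg T
    linarith
  have hd : 0 < h' - h := by linarith
  set Φ : Plane → ℝ := fun z => v z - m' * (z i - x i) + L / r ^ 2 * (z j - x j) ^ 2 +
    L / (h' - h) ^ 2 * max (z i - x i - h) 0 ^ 2 with hΦ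
  have hΦc : ContinuousOn Φ Q := by
    have := hv.mono hQS
    refine ContinuousOn.add (ContinuousOn.add (this.sub ?_) ?_) ?_ <;>
      exact Continuous.continuousOn (by fun_prop)
  obtain ⟨z, hzQ, hzmin⟩ := hQc.exists_isMinOn ⟨_, hxQ⟩ hΦc
  have hΦT : Φ z ≤ T := by
    have := hzmin hxQ
    simpa [hΦ, hij.symm, hT] using this
  have hlow : -(B + |m'| * h') ≤ v z - m' * (z i - x i) := by
    have h1 := abs_le.1 (hB z hzQ)
    have h2 : m' * (z i - x i) ≤ |m'| * h' :=
      mul_le_mul (le_abs_self _) hzQ.1.2 hzQ.1.1 (abs_nonneg _)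
    linarith [h1.1]
  have hLr : 0 < L / r ^ 2 := by positivity
  have hLh : 0 < L / (h' - h) ^ 2 := by positivity
  have hz1 : z i - x i ≠ 0 := by
    intro h0
    have hlt' : T < v z := hr₂v <| by
      rw [dist_eq_norm]
      have := hnorm z 0 h0
      rw [zero_smul, add_zero] at this
      exact (this.trans hzQ.2).trans_lt hrr₂
    have : v z ≤ Φ z := by
      simp only [hΦ, h0]
      have := mul_nonneg hLr.le (sq_nonneg (z j - x j))
      have := mul_nonneg hLh.le (sq_nonneg (max (0 - h) 0))
      linarith
    linarith
  have hz2 : |z j - x j| ≠ r := by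
    intro h0
    have h1 : L / r ^ 2 * (z j - x j) ^ 2 = L := by
      rw [← sq_abs (z j - x j), h0]; field_simp
    have h2 := mul_nonneg hLh.le (sq_nonneg (max (z i - x i - h) 0))
    simp only [hΦ, h1] at hΦT
    linarith [le_abs_self T]
  have hz3 : z i - x i ≠ h' := by
    intro h0
    have h1 : L / (h' - h) ^ 2 * max (z i - x i - h) 0 ^ 2 = L := by
      rw [h0, max_eq_left hd.le]; field_simp
    have h2 := mul_nonneg hLr.le (sq_nonneg (z j - x j))
    simp only [hΦ, h1] at hΦT
    linarith [le_abs_self T]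
  have hQz : Q ∈ 𝓝 z := by
    have c1 : Continuous fun y : Plane => y i - x i := by fun_prop
    have c2 : Continuous fun y : Plane => |y j - x j| := by fun_prop
    have a1 := (c1.tendsto z).eventually_const_lt (lt_of_le_of_ne hzQ.1.1 hz1.symm)
    have a2 := (c1.tendsto z).eventually_lt_const (lt_of_le_of_ne hzQ.1.2 hz3)
    have a3 := (c2.tendsto z).eventually_lt_const (lt_of_le_of_ne hzQ.2 hz2)
    filter_upwards [a1, a2, a3] with y h1 h2 h3 using ⟨⟨h1.le, h2.le⟩, h3.le⟩
  set M := max (z i - x i - h) 0 with hM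
  set p : Plane := EuclideanSpace.single i (m' - L / (h' - h) ^ 2 * (2 * M)) +
    EuclideanSpace.single j (-(L / r ^ 2 * (2 * (z j - x j)))) with hp
  have hpi : p i = m' - L / (h' - h) ^ 2 * (2 * M) := by simp [hp, hij]
  have hpj : p j = -(L / r ^ 2 * (2 * (z j - x j))) := by simp [hp, hij.symm]
  have hpD : p ∈ subdifferential openQuadrant v z := by
    refine mem_subdifferential_of_le (C := L / r ^ 2 + L / (h' - h) ^ 2) ?_
    filter_upwards [hQz] with y hy
    have hmin : Φ z ≤ Φ y := hzmin hy
    rw [inner_eq _ _ hij, norm_sq_eq _ hij, hpi, hpj]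
    simp only [hΦ, PiLp.sub_apply] at hmin ⊢
    rw [← hM] at hmin
    have h1 := mul_le_mul_of_nonneg_left (sq_max_sub_le h (z i - x i) (y i - x i)) hLh.le
    rw [← hM] at h1
    have h2 := mul_nonneg hLr.le (sq_nonneg (y i - z i))
    have h3 := mul_nonneg hLh.le (sq_nonneg (y j - z j))
    linarith
  have := hm z (hQS hzQ) p hpD
  rw [hpi] at this
  have : 0 ≤ L / (h' - h) ^ 2 * (2 * M) := by positivity
  linarith

/-- At a point near which `μ ≥ m`, every subgradient of a supersolution has components at least
`m`. Where `σ` is bounded away from zero the equation itself says so; the points where it is not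
are met only once by each line through `y` parallel to an axis, and `v` grows at rate at least `m`
along these lines away from them. -/
lemma le_apply_of_supersolution {μ σ v : Plane → ℝ} {m : ℝ} {y p : Plane}
    (hv : IsViscositySupersolution openQuadrant (hamiltonian μ σ) v)
    (hvc : ContinuousOn v openQuadrant)
    (hzero : {x ∈ openQuadrant | σ x = 0} ⊆ {x ∈ openQuadrant | μ x = 0})
    (hm : 0 < m) (hy : y ∈ openQuadrant) (hμ : ∀ᶠ z in 𝓝 y, m ≤ μ z)
    (hreg : ∀ᶠ z in 𝓝 y, z ≠ y → (z 0 = y 0 ∨ z 1 = y 1) → ContinuousAt (fun x => σ x ^ 2) z)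
    (hp : p ∈ subdifferential openQuadrant v y) (i : Fin 2) : m ≤ p i := by
  set S := interior {z | z ∈ openQuadrant ∧ m ≤ μ z ∧ ∃ s > 0, ∀ᶠ z' in 𝓝 z, s ≤ σ z' ^ 2}
    with hS
  have hSm : ∀ z ∈ S, ∀ q ∈ subdifferential openQuadrant v z, m ≤ q i := by
    intro z hz q hq
    obtain ⟨hzO, -, s, hs, hsσ⟩ := interior_subset hz
    have hμz : ∀ᶠ z' in 𝓝 z, m ≤ μ z' :=
      mem_of_superset (mem_interior_iff_mem_nhds.1 hz) fun z' h => h.2.1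
    obtain ⟨z', hz'H, hz's, hz'μ⟩ := ((hv.frequently_lt hzO hq hs).and_eventually
      (hsσ.and hμz)).exists
    have hpos : 0 < max (q 0 - μ z') 0 * max (q 1 - μ z') 0 := by
      unfold hamiltonian at hz'H; linarith
    have h0 : 0 < q 0 - μ z' := by
      by_contra! h; rw [max_eq_right h] at hpos; simp at hpos
    have h1 : 0 < q 1 - μ z' := by
      by_contra! h; rw [max_eq_right h] at hpos; simp at hpos
    fin_cases i
    · change m ≤ q 0; linarith
    · change m ≤ q 1; linarith
  have hev : ∀ᶠ z in 𝓝 y, z ≠ y → (z 0 = y 0 ∨ z 1 = y 1) → z ∈ S := by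
    filter_upwards [hreg, hμ.eventually_nhds,
      (isOpen_openQuadrant.eventually_mem hy).eventually_nhds]
      with z h1 h2 h3 hne hcoord
    have hzO := h3.self_of_nhds
    have hσz : 0 < σ z ^ 2 := by
      have : σ z ≠ 0 := fun h0 => by
        have h4 := (hzero ⟨hzO, h0⟩).2
        have h5 := h2.self_of_nhds
        linarith
      positivity
    have hc : ∀ᶠ z' in 𝓝 z, σ z ^ 2 / 2 ≤ σ z' ^ 2 :=
      ((h1 hne hcoord).eventually_const_lt (half_lt_self hσz)).mono fun _ h => le_of_lt h
    rw [hS, mem_interior_iff_mem_nhds]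
    filter_upwards [h2, h3, hc.eventually_nhds] with z' h5 h6 h7
    exact ⟨h6, h5, _, half_pos hσz, h7⟩
  obtain ⟨t₀, ht₀, ht₀S⟩ := mem_nhdsGT_iff_exists_Ioo_subset.1
    ((tendsto_sub_smul_axisVector y i).eventually hev)
  have hline : ∀ t ∈ Ioo 0 t₀, y - t • axisVector i ∈ S := by
    intro t ht
    refine ht₀S ht ?_ ?_
    · intro h
      have := congrArg (fun w : Plane => w i) h
      simp at this
      exact ht.1.ne' this
    · fin_cases i <;> simp
  refine le_apply_of_mem_subdifferential hy hp i ?_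
  filter_upwards [Ioo_mem_nhdsGT ht₀] with t ht
  have hlim : Tendsto (fun t' : ℝ => v (y - t' • axisVector i) - m * (t - t')) (𝓝[>] 0)
      (𝓝 (v y - m * (t - 0))) := by
    refine Tendsto.sub ?_ ?_
    · exact (hvc.continuousAt (isOpen_openQuadrant.mem_nhds hy)).tendsto.comp
        (tendsto_sub_smul_axisVector y i)
    · have : Continuous fun t' : ℝ => m * (t - t') := by fun_prop
      exact (this.tendsto 0).mono_left nhdsWithin_le_nhds
  rw [sub_zero] at hlim
  refine ge_of_tendsto hlim ?_
  filter_upwards [Ioo_mem_nhdsGT ht.1] with t' ht'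
  have hseg := add_mul_le_of_forall_subdifferential (S := S) isOpen_interior
    (hvc.mono fun z hz => (interior_subset hz).1) hSm (x := y - t • axisVector i)
    (h := t - t') (h' := t - t' / 2) (by linarith [ht'.2]) (by linarith [ht'.1]) (by
      intro s hs
      have : y - t • axisVector i + s • axisVector i = y - (t - s) • axisVector i := by module
      rw [this]
      exact hline _ ⟨by linarith [hs.2, ht'.1], by linarith [hs.1, ht.2]⟩)
  have : y - t • axisVector i + (t - t') • axisVector i = y - t' • axisVector i := by module
  rw [this] at hseg
  linarith

/-! ### Doubling of variables -/

/-- Doubling of variables with a shift: if `u - w` has a local maximum at `x₀`, then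
`u x - ‖x - x₀‖² - w y - ‖(x - y) / δ - e‖²` has a maximum with `x`, `y` close to `x₀` and with
`(x - y) / δ` close to `e`, provided `δ` is suitably small. -/
lemma exists_shifted_doubling_max {E : Type*} [NormedAddCommGroup E] [NormedSpace ℝ E]
    [ProperSpace E] {u w : E → ℝ} {x₀ : E} {r : ℝ} (hr : 0 < r)
    (hu : ContinuousOn u (Metric.closedBall x₀ r)) (hw : ContinuousOn w (Metric.closedBall x₀ r))
    (hmax : ∀ x ∈ Metric.closedBall x₀ r, u x - w x ≤ u x₀ - w x₀) (e : E) {ρ : ℝ}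
    (hρ : 0 < ρ) :
    ∃ δ > 0, ∃ x ∈ Metric.ball x₀ ρ, ∃ y ∈ Metric.ball x₀ ρ, ‖x - y - δ • e‖ < ρ * δ ∧
      ∀ x' ∈ Metric.closedBall x₀ r, ∀ y' ∈ Metric.closedBall x₀ r,
        u x' - ‖x' - x₀‖ ^ 2 - w y' - ‖x' - y' - δ • e‖ ^ 2 / δ ^ 2 ≤
          u x - ‖x - x₀‖ ^ 2 - w y - ‖x - y - δ • e‖ ^ 2 / δ ^ 2 := by
  set K := Metric.closedBall x₀ r with hK
  have hKc : IsCompact K := isCompact_closedBall x₀ r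
  have hx₀K : x₀ ∈ K := Metric.mem_closedBall_self hr.le
  obtain ⟨Bu, hBu⟩ := hKc.exists_bound_of_continuousOn hu
  obtain ⟨Bw, hBw⟩ := hKc.exists_bound_of_continuousOn hw
  set s := ρ ^ 2 / 12 with hs
  have hspos : 0 < s := by positivity
  obtain ⟨η, hη, hηw⟩ := Metric.uniformContinuousOn_iff.1
    (hKc.uniformContinuousOn_of_continuous hw) s hspos
  set D := Real.sqrt (2 * Bu + 2 * Bw + s) with hD
  have htend : ∀ c : ℝ, Tendsto (fun δ : ℝ => δ * c) (𝓝[>] 0) (𝓝 0) := fun c => by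
    have : Tendsto (fun δ : ℝ => δ * c) (𝓝 0) (𝓝 (0 * c)) := by
      apply Continuous.tendsto; fun_prop
    rw [zero_mul] at this
    exact this.mono_left nhdsWithin_le_nhds
  have hshift : Tendsto (fun δ : ℝ => x₀ + δ • e) (𝓝[>] 0) (𝓝 x₀) := by
    have : Tendsto (fun δ : ℝ => x₀ + δ • e) (𝓝 0) (𝓝 (x₀ + (0 : ℝ) • e)) := by
      apply Continuous.tendsto; fun_prop
    rw [zero_smul, add_zero] at this
    exact this.mono_left nhdsWithin_le_nhds
  have hsq : Tendsto (fun δ : ℝ => ‖δ • e‖ ^ 2) (𝓝[>] 0) (𝓝 0) := by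
    have : Tendsto (fun δ : ℝ => ‖δ • e‖ ^ 2) (𝓝 0) (𝓝 (‖(0 : ℝ) • e‖ ^ 2)) := by
      apply Continuous.tendsto; fun_prop
    rw [zero_smul, norm_zero, zero_pow two_ne_zero] at this
    exact this.mono_left nhdsWithin_le_nhds
  have hux₀ : ContinuousAt u x₀ := hu.continuousAt (Metric.closedBall_mem_nhds x₀ hr)
  obtain ⟨δ, ⟨⟨⟨⟨hδ1, hδ2⟩, hδ3⟩, hδ4⟩, hδ5⟩, hδ⟩ :=
    ((htend (D + ‖e‖)).eventually_lt_const hη |>.and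
      ((htend (ρ + ‖e‖)).eventually_lt_const (half_pos hρ)) |>.and
      (hshift.eventually (Metric.closedBall_mem_nhds x₀ hr)) |>.and
      ((hux₀.tendsto.comp hshift).eventually_const_lt (sub_lt_self (u x₀) hspos)) |>.and
      (hsq.eventually_lt_const hspos) |>.and self_mem_nhdsWithin).exists
  replace hδ : 0 < δ := hδ
  have hδ4' : u x₀ - s < u (x₀ + δ • e) := hδ4
  set Φ : E × E → ℝ := fun q => u q.1 - ‖q.1 - x₀‖ ^ 2 - w q.2 -
    ‖q.1 - q.2 - δ • e‖ ^ 2 / δ ^ 2 with hΦ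
  have hΦc : ContinuousOn Φ (K ×ˢ K) := by
    have h1 : ContinuousOn (fun q : E × E => u q.1) (K ×ˢ K) :=
      hu.comp continuousOn_fst fun q hq => hq.1
    have h2 : ContinuousOn (fun q : E × E => w q.2) (K ×ˢ K) :=
      hw.comp continuousOn_snd fun q hq => hq.2
    refine ((h1.sub ?_).sub h2).sub ?_ <;> exact Continuous.continuousOn (by fun_prop)
  obtain ⟨⟨x, y⟩, ⟨hxK, hyK⟩, hxy⟩ := (hKc.prod hKc).exists_isMaxOn ⟨(x₀, x₀), hx₀K, hx₀K⟩ hΦc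
  simp only at hxK hyK
  have hcmp : u (x₀ + δ • e) - ‖δ • e‖ ^ 2 - w x₀ ≤ Φ (x, y) := by
    have := hxy (show (x₀ + δ • e, x₀) ∈ K ×ˢ K from ⟨hδ3, hx₀K⟩)
    simpa [hΦ] using this
  simp only [hΦ] at hcmp
  have hpen : 0 ≤ ‖x - y - δ • e‖ ^ 2 / δ ^ 2 := by positivity
  have hxy_le : ∀ c : ℝ, ‖x - y - δ • e‖ ≤ c * δ → dist x y ≤ δ * (c + ‖e‖) := fun c hc => by
    rw [dist_eq_norm]
    calc ‖x - y‖ = ‖(x - y - δ • e) + δ • e‖ := by congr 1; abel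
      _ ≤ c * δ + ‖δ • e‖ := (norm_add_le _ _).trans (add_le_add hc le_rfl)
      _ = δ * (c + ‖e‖) := by rw [norm_smul, Real.norm_eq_abs, abs_of_pos hδ]; ring
  -- a first crude bound on the penalty gives `x - y → 0`
  have hdist : dist x y < η := by
    refine (hxy_le D ?_).trans_lt hδ1
    have h1 := abs_le.1 (hBu x hxK)
    have h2 := abs_le.1 (hBw y hyK)
    have h3 := abs_le.1 (hBu _ hδ3)
    have h4 := abs_le.1 (hBw _ hx₀K)
    have h5 : ‖x - y - δ • e‖ ^ 2 / δ ^ 2 ≤ 2 * Bu + 2 * Bw + s := by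
      linarith [sq_nonneg ‖x - x₀‖]
    rw [← div_le_iff₀ hδ]
    refine Real.le_sqrt_of_sq_le ?_
    rwa [div_pow]
  have hwxy := (abs_lt.1 (hηw x hxK y hyK hdist)).2
  have hm := hmax x hxK
  have htotal : ‖x - x₀‖ ^ 2 + ‖x - y - δ • e‖ ^ 2 / δ ^ 2 < 3 * s := by linarith
  have hx : ‖x - x₀‖ < ρ / 2 := by
    refine lt_of_pow_lt_pow_left₀ 2 (by positivity) ?_
    have : (ρ / 2) ^ 2 = 3 * s := by rw [hs]; ring
    linarith
  have hd : ‖x - y - δ • e‖ < ρ * δ := by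
    rw [← div_lt_iff₀ hδ]
    refine lt_of_pow_lt_pow_left₀ 2 hρ.le ?_
    rw [div_pow]
    have : ρ ^ 2 = 12 * s := by rw [hs]; ring
    linarith [sq_nonneg ‖x - x₀‖]
  refine ⟨δ, hδ, x, ?_, y, ?_, hd, fun x' hx' y' hy' => ?_⟩
  · rw [mem_ball_iff_norm]; linarith
  · have h1 := (hxy_le ρ hd.le).trans_lt hδ2
    rw [Metric.mem_ball]
    rw [← dist_eq_norm] at hx
    have h2 := dist_triangle_left y x₀ x
    linarith
  · exact hxy (show (x', y') ∈ K ×ˢ K from ⟨hx', hy'⟩)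

/-- The local structure of the coefficients that the comparison argument uses at a point `x₀`:
in one of the two diagonal directions transversal to increasing curves, `μ` and `σ²` do not jump
up, and for `y` close to `x₀` the function `σ²` is continuous at all points near `y`, other than
`y` itself, which share a coordinate with `y`. The sign `ζ = 1` stands for steps from `z` to `x`
towards the upper left, `ζ = -1` for steps towards the lower right. -/
structure IsAdmissible (μ σ : Plane → ℝ) (x₀ : Plane) : Prop where
  cone : ∃ ζ : ℝ, (ζ = -1 ∨ ζ = 1) ∧ ∀ τ > 0, ∃ W ∈ 𝓝 x₀, ∀ x ∈ W, ∀ z ∈ W,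
    ζ * (x 0 - z 0) < 0 → 0 < ζ * (x 1 - z 1) → μ x ≤ μ z + τ ∧ σ x ^ 2 ≤ σ z ^ 2 + τ
  regular : ∀ᶠ y in 𝓝 x₀, ∀ᶠ z in 𝓝 y, z ≠ y → (z 0 = y 0 ∨ z 1 = y 1) →
    ContinuousAt (fun x => σ x ^ 2) z

/-- `u - (v + ψ)` has no local maximum at an admissible point if `ψ` is increasing in both
variables at a positive rate: `v + ψ` is then a strict supersolution. The shift in the doubling
of variables puts the contact point for `u` on the side of the smaller coefficients, and the
componentwise strictness absorbs every error term, so that no bound on the gradients is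
needed. -/
lemma not_isLocalMax_sub {μ σ u v ψ : Plane → ℝ} {x₀ : Plane} {r ε A : ℝ}
    (hu : IsViscositySubsolution openQuadrant (hamiltonian μ σ) u)
    (hv : IsViscositySupersolution openQuadrant (hamiltonian μ σ) v)
    (huc : ContinuousOn u openQuadrant) (hvc : ContinuousOn v openQuadrant)
    (hvm : IsMonotone v)
    (hzero : {x ∈ openQuadrant | σ x = 0} ⊆ {x ∈ openQuadrant | μ x = 0})
    (hadm : IsAdmissible μ σ x₀) (hε : 0 < ε) (hψc : Continuous ψ)
    (hψ : ∀ y, ∃ g : Plane, (∀ i, ε ≤ g i) ∧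
      ∀ z, ψ z ≤ ψ y + inner ℝ g (z - y) + A * ‖z - y‖ ^ 2)
    (hr : 0 < r) (hball : Metric.closedBall x₀ r ⊆ openQuadrant) :
    ¬ ∀ x ∈ Metric.closedBall x₀ r, u x - (v x + ψ x) ≤ u x₀ - (v x₀ + ψ x₀) := by
  intro hmax
  obtain ⟨ζ, hζ, hcone⟩ := hadm.cone
  set τ := min (ε / 4) (ε ^ 2 / 16) with hτ
  have hτpos : 0 < τ := by positivity
  have hτ1 : τ ≤ ε / 4 := min_le_left _ _
  have hτ2 : τ ≤ ε ^ 2 / 16 := min_le_right _ _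
  obtain ⟨W, hW, hWcone⟩ := hcone τ hτpos
  obtain ⟨ρ₁, hρ₁, hρ₁W⟩ := Metric.mem_nhds_iff.1 (inter_mem hW hadm.regular)
  set ρ := min (min ρ₁ r) (min (ε / 8) (1 / 2)) with hρ
  have hρpos : 0 < ρ := by positivity
  have hρρ₁ : ρ ≤ ρ₁ := (min_le_left _ _).trans (min_le_left _ _)
  have hρr : ρ ≤ r := (min_le_left _ _).trans (min_le_right _ _)
  have hρε : ρ ≤ ε / 8 := (min_le_right _ _).trans (min_le_left _ _)
  have hρ2 : ρ ≤ 1 / 2 := (min_le_right _ _).trans (min_le_right _ _)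
  obtain ⟨δ, hδ, x, hx, y, hy, hxy, hΦ⟩ := exists_shifted_doubling_max hr (huc.mono hball)
    ((hvc.mono hball).add hψc.continuousOn) hmax (!₂[-ζ, ζ] : Plane) hρpos
  set a : Plane := x - y - δ • (!₂[-ζ, ζ] : Plane) with ha
  have hballs : ∀ {z : Plane}, z ∈ Metric.ball x₀ ρ → Metric.closedBall x₀ r ∈ 𝓝 z := fun hz =>
    mem_of_superset (Metric.isOpen_ball.mem_nhds hz)
      ((Metric.ball_subset_ball hρr).trans Metric.ball_subset_closedBall)
  have hxO : x ∈ openQuadrant := hball (mem_of_mem_nhds (hballs hx))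
  have hyO : y ∈ openQuadrant := hball (mem_of_mem_nhds (hballs hy))
  obtain ⟨g, hg, hgψ⟩ := hψ y
  set p : Plane := (2 / δ ^ 2) • a with hp
  have hsup : p + (2 : ℝ) • (x - x₀) ∈ superdifferential openQuadrant u x := by
    refine mem_superdifferential_of_le (C := 1 + 1 / δ ^ 2) ?_
    filter_upwards [hballs hx] with z hz
    have h1 := hΦ z hz y (mem_of_mem_nhds (hballs hy))
    have h2 : z - y - δ • (!₂[-ζ, ζ] : Plane) = a + (z - x) := by rw [ha]; abel
    have h3 : z - x₀ = (x - x₀) + (z - x) := by abel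
    rw [h2, h3, norm_add_sq_real, norm_add_sq_real] at h1
    rw [inner_add_left, hp, real_inner_smul_left, real_inner_smul_left]
    have h4 : (‖a‖ ^ 2 + 2 * inner ℝ a (z - x) + ‖z - x‖ ^ 2) / δ ^ 2 =
      ‖a‖ ^ 2 / δ ^ 2 + 2 / δ ^ 2 * inner ℝ a (z - x) + 1 / δ ^ 2 * ‖z - x‖ ^ 2 := by ring
    rw [h4] at h1
    linarith
  have hsub : p - g ∈ subdifferential openQuadrant v y := by
    refine mem_subdifferential_of_le (C := A + 1 / δ ^ 2) ?_
    filter_upwards [hballs hy] with z hz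
    have h1 := hΦ x (mem_of_mem_nhds (hballs hx)) z hz
    have h2 : x - z - δ • (!₂[-ζ, ζ] : Plane) = a - (z - y) := by rw [ha]; abel
    rw [h2, norm_sub_sq_real a] at h1
    simp only [Pi.add_apply] at h1
    rw [inner_sub_left, hp, real_inner_smul_left]
    have h4 : (‖a‖ ^ 2 - 2 * inner ℝ a (z - y) + ‖z - y‖ ^ 2) / δ ^ 2 =
      ‖a‖ ^ 2 / δ ^ 2 - 2 / δ ^ 2 * inner ℝ a (z - y) + 1 / δ ^ 2 * ‖z - y‖ ^ 2 := by ring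
    rw [h4] at h1
    have h5 := hgψ z
    linarith
  -- near `(x, y)` all pairs of points differ by a vector in the cone
  have hpair : ∀ x' z : Plane, ‖x' - x‖ < δ / 4 → ‖z - y‖ < δ / 4 →
      ζ * (x' 0 - z 0) < 0 ∧ 0 < ζ * (x' 1 - z 1) := by
    intro x' z hx' hz
    have haδ : ‖a‖ < δ / 2 := hxy.trans_le (by nlinarith)
    have h0 := abs_lt.1 ((abs_apply_le_norm a 0).trans_lt haδ)
    have h1 := abs_lt.1 ((abs_apply_le_norm a 1).trans_lt haδ)
    have h2 := abs_lt.1 ((abs_apply_le_norm _ 0).trans_lt hx')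
    have h3 := abs_lt.1 ((abs_apply_le_norm _ 1).trans_lt hx')
    have h4 := abs_lt.1 ((abs_apply_le_norm _ 0).trans_lt hz)
    have h5 := abs_lt.1 ((abs_apply_le_norm _ 1).trans_lt hz)
    simp only [ha, PiLp.sub_apply, PiLp.smul_apply, smul_eq_mul, Matrix.cons_val_zero,
      Matrix.cons_val_one] at h0 h1 h2 h3 h4 h5
    rcases hζ with rfl | rfl <;> constructor <;> linarith
  have hnear : ∀ w ∈ Metric.ball x₀ ρ, ∀ᶠ z in 𝓝 w, z ∈ W ∧ ‖z - w‖ < δ / 4 := by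
    intro w hw
    filter_upwards [Metric.isOpen_ball.mem_nhds hw,
      Metric.ball_mem_nhds w (show 0 < δ / 4 by positivity)] with z hz hz'
    exact ⟨(hρ₁W (Metric.ball_subset_ball hρρ₁ hz)).1, mem_ball_iff_norm.1 hz'⟩
  obtain ⟨x', hx'H, hx'W, hx'x⟩ :=
    ((hu.frequently_lt hxO hsup hτpos).and_eventually (hnear x hx)).exists
  have hcmp : ∀ᶠ z in 𝓝 y, μ x' ≤ μ z + τ ∧ σ x' ^ 2 ≤ σ z ^ 2 + τ := by
    filter_upwards [hnear y hy] with z hz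
    have := hpair x' z hx'x hz.2
    exact hWcone x' hx'W z hz.1 this.1 this.2
  -- needed where `σ` degenerates near `y`, so that the inequality at `y` does not bound `p - g`
  have hP : ∀ i, μ x' - τ ≤ (p - g) i := by
    intro i
    rcases le_or_gt (μ x' - τ) 0 with hm | hm
    · exact hm.trans (subdifferential_nonneg hvm hyO hsub i)
    · exact le_apply_of_supersolution hv hvc hzero hm hyO
        (hcmp.mono fun z hz => by linarith [hz.1])
        (hρ₁W (Metric.ball_subset_ball hρρ₁ hy)).2 hsub i
  obtain ⟨z, hzH, hzμ, hzσ⟩ := ((hv.frequently_lt hyO hsub hτpos).and_eventually hcmp).exists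
  unfold hamiltonian at hx'H hzH
  have hq : ∀ i, (p - g) i + 3 * ε / 4 ≤ (p + (2 : ℝ) • (x - x₀)) i := by
    intro i
    have h1 := abs_lt.1 ((abs_apply_le_norm (x - x₀) i).trans_lt (mem_ball_iff_norm.1 hx))
    have h2 := hg i
    simp only [PiLp.sub_apply, PiLp.add_apply, PiLp.smul_apply, smul_eq_mul] at h1 ⊢
    linarith [h1.1]
  -- with `bᵢ = (p - g)ᵢ - μ x' + τ ≥ 0`, the two viscosity inequalities become
  -- `b₀ b₁ > σ² x' - 2 τ` and `(b₀ + ε / 2) (b₁ + ε / 2) < σ² x' + τ`, while `3 τ < ε² / 4`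
  have hup : ∀ i, max ((p - g) i - μ z) 0 ≤ (p - g) i - μ x' + τ := fun i =>
    max_le (by linarith) (by linarith [hP i])
  have hdown : ∀ i, (p - g) i - μ x' + τ + ε / 2 ≤
      max ((p + (2 : ℝ) • (x - x₀)) i - μ x') 0 := fun i =>
    le_max_of_le_left (by linarith [hq i])
  have hb0 : 0 ≤ (p - g) 0 - μ x' + τ := by linarith [hP 0]
  have hb1 : 0 ≤ (p - g) 1 - μ x' + τ := by linarith [hP 1]
  have h1 := mul_le_mul (hup 0) (hup 1) (le_max_right _ _) hb0
  have h2 := mul_le_mul (hdown 0) (hdown 1) (by positivity) (le_max_right _ _)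
  nlinarith [mul_nonneg hb0 hε.le, mul_nonneg hb1 hε.le]

/-- Comparison on the box `[0,R₀) × [0,R₁)`, given that every point of the closed box either has
`u ≤ v` or lies in the open quadrant and is admissible. No condition is needed on the upper and
right sides, since a penalty increasing in each variable keeps `v` a supersolution. -/
lemma le_on_box {μ σ u v : Plane → ℝ} {R : Plane}
    (hu : IsViscositySubsolution openQuadrant (hamiltonian μ σ) u)
    (hv : IsViscositySupersolution openQuadrant (hamiltonian μ σ) v)
    (huc : ContinuousOn u quadrant) (hvc : ContinuousOn v quadrant)
    (hvm : IsMonotone v)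
    (hzero : {x ∈ openQuadrant | σ x = 0} ⊆ {x ∈ openQuadrant | μ x = 0})
    (hR : ∀ x ∈ quadrant, (∀ i, x i ≤ R i) →
      u x ≤ v x ∨ (x ∈ openQuadrant ∧ ((∀ i, x i < R i) → IsAdmissible μ σ x)))
    {x : Plane} (hx : x ∈ quadrant) (hxR : ∀ i, x i < R i) : u x ≤ v x := by
  by_contra! hlt
  set Q : Set Plane := {z | z ∈ quadrant ∧ ∀ i, z i ≤ R i} with hQ
  have hxQ : x ∈ Q := ⟨hx, fun i => (hxR i).le⟩
  have hQcl : IsClosed Q := by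
    have c0 : Continuous fun z : Plane => z 0 := by fun_prop
    have c1 : Continuous fun z : Plane => z 1 := by fun_prop
    have : Q = quadrant ∩ ({z : Plane | z 0 ≤ R 0} ∩ {z : Plane | z 1 ≤ R 1}) := by
      ext z; simp only [hQ, Fin.forall_fin_two]; rfl
    rw [this]
    exact isClosed_quadrant.inter
      ((isClosed_le c0 continuous_const).inter (isClosed_le c1 continuous_const))
  have hQc : IsCompact Q := by
    refine Metric.isCompact_of_isClosed_isBounded hQcl ?_
    refine (Metric.isBounded_closedBall (x := (0 : Plane)) (r := R 0 + R 1)).subset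
      fun z hz => ?_
    rw [mem_closedBall_zero_iff]
    refine (norm_le_abs_add_abs z (show (0 : Fin 2) ≠ 1 by decide)).trans ?_
    rw [abs_of_nonneg hz.1.1, abs_of_nonneg hz.1.2]
    exact add_le_add (hz.2 0) (hz.2 1)
  have hQq : Q ⊆ quadrant := fun z hz => hz.1
  have hcont : ContinuousOn (fun z => u z - v z) Q := (huc.mono hQq).sub (hvc.mono hQq)
  obtain ⟨B, hB⟩ := hQc.exists_bound_of_continuousOn hcont
  have hBpos : 0 < B := by
    have := (abs_le.1 (hB x hxQ)).2
    linarith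
  obtain ⟨ε, hε, hεx⟩ : ∃ ε > 0, ε * (x 0 + x 1) < u x - v x := by
    have h0 : 0 < x 0 + x 1 + 1 := by linarith [hx.1, hx.2]
    refine ⟨(u x - v x) / (x 0 + x 1 + 1), div_pos (by linarith) h0, ?_⟩
    rw [div_mul_eq_mul_div, div_lt_iff₀ h0]
    nlinarith
  set c : Fin 2 → ℝ := fun i => B / (R i - x i) ^ 2 with hc
  have hcpos : ∀ i, 0 < c i := fun i =>
    div_pos hBpos (pow_pos (sub_pos.2 (hxR i)) 2)
  set ψ : Plane → ℝ := fun z => ε * (z 0 + z 1) + c 0 * max (z 0 - x 0) 0 ^ 2 +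
    c 1 * max (z 1 - x 1) 0 ^ 2 with hψ
  have hψc : Continuous ψ := by rw [hψ]; fun_prop
  obtain ⟨z, hzQ, hzmax⟩ := hQc.exists_isMaxOn ⟨x, hxQ⟩ (hcont.sub hψc.continuousOn)
  have hzpos : 0 < u z - v z - ψ z := by
    have h1 : u x - v x - ψ x ≤ u z - v z - ψ z := hzmax hxQ
    have h2 : ψ x = ε * (x 0 + x 1) := by simp [hψ]
    linarith
  have hψ0 : 0 ≤ ε * (z 0 + z 1) := mul_nonneg hε.le (add_nonneg hzQ.1.1 hzQ.1.2)
  have hψ1 : 0 ≤ c 0 * max (z 0 - x 0) 0 ^ 2 := mul_nonneg (hcpos 0).le (sq_nonneg _)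
  have hψ2 : 0 ≤ c 1 * max (z 1 - x 1) 0 ^ 2 := mul_nonneg (hcpos 1).le (sq_nonneg _)
  have hzB := (abs_le.1 (hB z hzQ)).2
  have hedge : ∀ i, z i = R i → c i * max (z i - x i) 0 ^ 2 = B := by
    intro i hi
    have := sub_pos.2 (hxR i)
    rw [hi, max_eq_left this.le, hc]
    field_simp
  have hzR : ∀ i, z i < R i := by
    rw [Fin.forall_fin_two]
    refine ⟨lt_of_le_of_ne (hzQ.2 0) fun h => ?_, lt_of_le_of_ne (hzQ.2 1) fun h => ?_⟩
    · have := hedge 0 h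
      simp only [hψ] at hzpos
      linarith
    · have := hedge 1 h
      simp only [hψ] at hzpos
      linarith
  obtain hle | ⟨hzO, hadm⟩ := hR z hzQ.1 hzQ.2
  · simp only [hψ] at hzpos
    linarith
  have hQz : Q ∩ openQuadrant ∈ 𝓝 z := by
    have c0 : Continuous fun z : Plane => z 0 := by fun_prop
    have c1 : Continuous fun z : Plane => z 1 := by fun_prop
    filter_upwards [isOpen_openQuadrant.mem_nhds hzO, (c0.tendsto z).eventually_lt_const (hzR 0),
      (c1.tendsto z).eventually_lt_const (hzR 1)] with y h1 h2 h3
    exact ⟨⟨openQuadrant_subset_quadrant h1, Fin.forall_fin_two.2 ⟨h2.le, h3.le⟩⟩, h1⟩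
  obtain ⟨r, hr, hrQ⟩ := Metric.nhds_basis_closedBall.mem_iff.1 hQz
  refine not_isLocalMax_sub (A := c 0 + c 1) hu hv (huc.mono openQuadrant_subset_quadrant)
    (hvc.mono openQuadrant_subset_quadrant) hvm hzero (hadm hzR) hε hψc (fun y => ?_) hr
    (hrQ.trans inter_subset_right) fun y hy => ?_
  · refine ⟨!₂[ε + c 0 * (2 * max (y 0 - x 0) 0), ε + c 1 * (2 * max (y 1 - x 1) 0)], ?_, ?_⟩
    · rw [Fin.forall_fin_two]
      constructor
      · have := mul_nonneg (hcpos 0).le (mul_nonneg zero_le_two (le_max_right (y 0 - x 0) 0))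
        simpa using this
      · have := mul_nonneg (hcpos 1).le (mul_nonneg zero_le_two (le_max_right (y 1 - x 1) 0))
        simpa using this
    · intro w
      rw [inner_eq _ _ (show (0 : Fin 2) ≠ 1 by decide),
        norm_sq_eq _ (show (0 : Fin 2) ≠ 1 by decide)]
      have h0 := mul_le_mul_of_nonneg_left (sq_max_sub_le (x 0) (y 0) (w 0)) (hcpos 0).le
      have h1 := mul_le_mul_of_nonneg_left (sq_max_sub_le (x 1) (y 1) (w 1)) (hcpos 1).le
      have h2 := mul_nonneg (hcpos 1).le (sq_nonneg (w 0 - y 0))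
      have h3 := mul_nonneg (hcpos 0).le (sq_nonneg (w 1 - y 1))
      simp only [hψ, PiLp.sub_apply, Matrix.cons_val_zero, Matrix.cons_val_one]
      linarith
  · have : u y - v y - ψ y ≤ u z - v z - ψ z := hzmax (hrQ hy).1
    linarith

/-! ### Components and the region below the decreasing curve -/

lemma IsComponent.subset_of_isPreconnected {S C P : Set Plane} (hC : IsComponent S C)
    (hP : IsPreconnected P) (hPS : P ⊆ S) {z : Plane} (hzP : z ∈ P) (hzC : z ∈ C) : P ⊆ C := by
  obtain ⟨b, -, rfl⟩ := hC
  rw [connectedComponentIn_eq hzC]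
  exact hP.subset_connectedComponentIn hzP hPS

lemma IsComponent.eq_of_mem {S C D : Set Plane} (hC : IsComponent S C) (hD : IsComponent S D)
    {z : Plane} (hzC : z ∈ C) (hzD : z ∈ D) : C = D := by
  obtain ⟨b, -, rfl⟩ := hC
  obtain ⟨b', -, rfl⟩ := hD
  rw [connectedComponentIn_eq hzC, connectedComponentIn_eq hzD]

lemma IsComponent.subset {S C : Set Plane} (hC : IsComponent S C) : C ⊆ S := by
  obtain ⟨b, -, rfl⟩ := hC
  exact connectedComponentIn_subset S b

lemma apply_mem_uIcc_of_mem_segment {p m z : Plane} (hz : z ∈ segment ℝ p m) (i : Fin 2) :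
    z i ∈ uIcc (p i) (m i) := by
  rw [← segment_eq_uIcc]
  obtain ⟨a, b, ha, hb, hab, rfl⟩ := hz
  exact ⟨a, b, ha, hb, hab, by simp⟩

lemma isPreconnected_of_segments {P : Set Plane}
    (h : ∀ p ∈ P, ∀ q ∈ P, ∃ m, segment ℝ p m ⊆ P ∧ segment ℝ q m ⊆ P) : IsPreconnected P := by
  refine isPreconnected_of_forall_pair fun p hp q hq => ?_
  obtain ⟨m, h1, h2⟩ := h p hp q hq
  exact ⟨segment ℝ p m ∪ segment ℝ q m, union_subset h1 h2, Or.inl (left_mem_segment ℝ p m),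
    Or.inr (left_mem_segment ℝ q m), (convex_segment p m).isPreconnected.union m
      (right_mem_segment ℝ p m) (right_mem_segment ℝ q m) (convex_segment q m).isPreconnected⟩

namespace CurveSystem

variable (G : CurveSystem)

lemma om_subset : G.Om ⊆ quadrant \ G.Gam := G.om_component.subset

lemma eq_of_mem_gam_of_le {g g' : Plane} (hg : g ∈ G.Gam) (hg' : g' ∈ G.Gam)
    (h0 : g 0 ≤ g' 0) (h1 : g 1 ≤ g' 1) : g = g' := by
  obtain ⟨f, -, hf, -, -, hG⟩ := G.gam_curve
  rw [hG] at hg hg'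
  obtain ⟨s, hs, rfl⟩ := hg
  obtain ⟨t, ht, rfl⟩ := hg'
  replace h0 : s ≤ t := h0
  replace h1 : f s ≤ f t := h1
  rcases h0.eq_or_lt with rfl | hlt
  · rfl
  · exact absurd (hf hs ht hlt) (not_lt.2 h1)

/-- Otherwise the diagonal ray through `z` would not meet `Γ`, and `Ω` would be unbounded. -/
lemma not_le_of_mem_om {z g : Plane} (hz : z ∈ G.Om) (hg : g ∈ G.Gam) :
    ¬ (g 0 ≤ z 0 ∧ g 1 ≤ z 1) := by
  rintro ⟨h0, h1⟩
  set P : Set Plane := (fun t : ℝ => z + t • (!₂[1, 1] : Plane)) '' Ici 0 with hP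
  have hPpre : IsPreconnected P := isPreconnected_Ici.image _ (by fun_prop)
  have hzS := G.om_subset hz
  have hPS : P ⊆ quadrant \ G.Gam := by
    rintro _ ⟨t, ht, rfl⟩
    replace ht : 0 ≤ t := ht
    refine ⟨⟨?_, ?_⟩, fun hmem => ?_⟩
    · simpa using add_nonneg hzS.1.1 ht
    · simpa using add_nonneg hzS.1.2 ht
    · have h := G.eq_of_mem_gam_of_le hg hmem (by simpa using by linarith)
        (by simpa using by linarith)
      have e0 := congrArg (fun w : Plane => w 0) h
      have e1 := congrArg (fun w : Plane => w 1) h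
      simp only [PiLp.add_apply, PiLp.smul_apply, Matrix.cons_val_zero, Matrix.cons_val_one,
        smul_eq_mul, mul_one] at e0 e1
      have : g = z := by
        ext i
        fin_cases i
        · change g 0 = z 0; linarith
        · change g 1 = z 1; linarith
      exact hzS.2 (this ▸ hg)
  have hPO : P ⊆ G.Om := G.om_component.subset_of_isPreconnected hPpre hPS
    (z := z) ⟨0, self_mem_Ici, by simp⟩ hz
  obtain ⟨B, hB⟩ := G.om_bounded.subset_closedBall 0
  have hmem : z + (|B| + 1) • (!₂[1, 1] : Plane) ∈ P := ⟨|B| + 1, by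
    rw [mem_Ici]; positivity, rfl⟩
  have h2 := mem_closedBall_zero_iff.1 (hB (hPO hmem))
  have h3 := (le_abs_self _).trans (abs_apply_le_norm (z + (|B| + 1) • (!₂[1, 1] : Plane)) 0)
  simp only [PiLp.add_apply, PiLp.smul_apply, Matrix.cons_val_zero, smul_eq_mul, mul_one] at h3
  linarith [hzS.1.1, le_abs_self B]

/-- The region `Ω` contains with each of its points everything to its lower left. -/
lemma mem_om_of_le {y z : Plane} (hz : z ∈ G.Om) (hy : y ∈ quadrant) (h : ∀ i, y i ≤ z i) :
    y ∈ G.Om := by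
  have hseg : segment ℝ y z ⊆ quadrant \ G.Gam := by
    intro w hw
    have hc := fun i => apply_mem_uIcc_of_mem_segment hw i
    have h0 := hc 0
    have h1 := hc 1
    rw [uIcc_of_le (h _)] at h0 h1
    exact ⟨⟨hy.1.trans h0.1, hy.2.trans h1.1⟩, fun hwG => G.not_le_of_mem_om hz hwG ⟨h0.2, h1.2⟩⟩
  exact G.om_component.subset_of_isPreconnected (convex_segment y z).isPreconnected hseg
    (right_mem_segment ℝ y z) hz (left_mem_segment ℝ y z)

/-! ### The increasing curves -/

lemma isBounded_graphCurve {I : Set ℝ} {f : ℝ → ℝ} {a b c : ℝ} (hf : StrictMonoOn f I)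
    (ha : IsLeast I a) (hb : ∀ t ∈ I, t ≤ b) (hc : ∀ t ∈ I, f t ≤ c) :
    Bornology.IsBounded (graphCurve I f) := by
  refine (Metric.isBounded_closedBall (x := (0 : Plane))
    (r := (|a| + |b|) + (|f a| + |c|))).subset ?_
  rintro _ ⟨t, ht, rfl⟩
  rw [mem_closedBall_zero_iff]
  refine (norm_le_abs_add_abs _ (show (0 : Fin 2) ≠ 1 by decide)).trans ?_
  have h1 : |t| ≤ |a| + |b| := by
    rw [abs_le]
    constructor <;> linarith [ha.2 ht, hb t ht, neg_abs_le a, le_abs_self b, abs_nonneg a,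
      abs_nonneg b]
  have h2 : |f t| ≤ |f a| + |c| := by
    have h3 : f a ≤ f t := hf.monotoneOn ha.1 ht (ha.2 ht)
    rw [abs_le]
    constructor <;> linarith [hc t ht, neg_abs_le (f a), le_abs_self c, abs_nonneg (f a),
      abs_nonneg c]
  exact add_le_add h1 h2

lemma isClosed_gams (i : ℤ) : IsClosed (G.Gams i) := by
  obtain ⟨I, f, a, hI, hfc, hf, hG, ha, -, hub⟩ := G.gams_curve i
  refine isClosed_of_closure_subset fun x hx => ?_
  obtain ⟨s, hs, hsx⟩ := mem_closure_iff_seq_limit.1 hx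
  rw [hG] at hs hub ⊢
  choose t htI hts using hs
  have hst0 : ∀ n, s n 0 = t n := fun n => by rw [← hts n]; rfl
  have hst1 : ∀ n, s n 1 = f (t n) := fun n => by rw [← hts n]; rfl
  have hc : ∀ k : Fin 2, Continuous fun z : Plane => z k := fun k => by fun_prop
  have ht : Tendsto t atTop (𝓝 (x 0)) := by
    simpa only [Function.comp_def, hst0] using ((hc 0).tendsto x).comp hsx
  have hft : Tendsto (fun n => f (t n)) atTop (𝓝 (x 1)) := by
    simpa only [Function.comp_def, hst1] using ((hc 1).tendsto x).comp hsx
  have hax : a ≤ x 0 := ge_of_tendsto' ht fun n => ha.2 (htI n)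
  have hxI : x 0 ∈ I := by
    by_contra hxI
    have hlt : ∀ τ ∈ I, τ < x 0 := fun τ hτ => by
      by_contra! h
      exact hxI (hI.out ha.1 hτ ⟨hax, h⟩)
    refine hub (isBounded_graphCurve hf ha (fun τ hτ => (hlt τ hτ).le) (c := x 1) fun τ hτ => ?_)
    refine ge_of_tendsto hft ?_
    filter_upwards [ht.eventually_const_lt (hlt τ hτ)] with n hn
    exact hf.monotoneOn hτ (htI n) hn.le
  refine ⟨x 0, hxI, ?_⟩
  have hlim : Tendsto (fun n => f (t n)) atTop (𝓝 (f (x 0))) :=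
    (hfc (x 0) hxI).tendsto.comp (tendsto_nhdsWithin_iff.2 ⟨ht, Eventually.of_forall htI⟩)
  have hx1 := tendsto_nhds_unique hft hlim
  ext k
  fin_cases k
  · rfl
  · exact hx1.symm

lemma mem_nhds_avoiding {x : Plane} : (⋂ i, ⋂ (_ : x ∉ G.Gams i), (G.Gams i)ᶜ) ∈ 𝓝 x :=
  G.gams_locallyFinite.iInter_compl_mem_nhds G.isClosed_gams x

/-- Near an interior point off the closure of `Ω`, a curve `Γ_i` through it is the graph of a
continuous strictly increasing function on a full neighbourhood: its starting point lies
elsewhere. -/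
lemma exists_local_graph {i : ℤ} {x₀ : Plane} (hx₀ : x₀ ∈ G.Gams i) (hO : x₀ ∈ openQuadrant)
    (hΩ : x₀ ∉ closure G.Om) :
    ∃ (f : ℝ → ℝ) (r : ℝ), 0 < r ∧ ContinuousOn f (Ioo (x₀ 0 - r) (x₀ 0 + r)) ∧
      StrictMonoOn f (Ioo (x₀ 0 - r) (x₀ 0 + r)) ∧
      ∀ z : Plane, z 0 ∈ Ioo (x₀ 0 - r) (x₀ 0 + r) → (z ∈ G.Gams i ↔ z 1 = f (z 0)) := by
  obtain ⟨I, f, a, hI, hfc, hf, hG, ha, hfr, hub⟩ := G.gams_curve i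
  have hx₀' := hx₀
  rw [hG] at hx₀' hub
  obtain ⟨t, ht, rfl⟩ := hx₀'
  set x₀ : Plane := !₂[t, f t] with hx₀def
  have hat : a ≠ t := by
    rintro rfl
    refine hfr.2 (mem_interior_iff_mem_nhds.2 ?_)
    filter_upwards [quadrant_mem_nhds hO, isClosed_closure.isOpen_compl.mem_nhds hΩ] with z h1 h2
    exact ⟨h1, fun h => h2 (subset_closure h)⟩
  have hat' : a < t := lt_of_le_of_ne (ha.2 ht) hat
  obtain ⟨b, hb, htb⟩ : ∃ b ∈ I, t < b := by
    by_contra! h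
    exact hub (isBounded_graphCurve hf ha h fun τ hτ => hf.monotoneOn hτ ht (h τ hτ))
  have hsub : Ioo (t - min (t - a) (b - t)) (t + min (t - a) (b - t)) ⊆ I := fun τ hτ =>
    hI.out ha.1 hb ⟨by linarith [hτ.1, min_le_left (t - a) (b - t)],
      by linarith [hτ.2, min_le_right (t - a) (b - t)]⟩
  refine ⟨f, min (t - a) (b - t), lt_min (by linarith) (by linarith), hfc.mono hsub,
    hf.mono hsub, fun z hz => ?_⟩
  rw [hG]
  constructor
  · rintro ⟨s, -, rfl⟩
    rfl
  · intro h
    refine ⟨z 0, hsub hz, ?_⟩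
    ext k
    fin_cases k
    · rfl
    · exact h.symm

lemma isComponent_oms (j : ℤ) : IsComponent ((quadrant \ G.Om) \ ⋃ i, G.Gams i) (G.Oms j) :=
  (G.oms_component _).2 ⟨j, rfl⟩

lemma eq_of_mem_oms {j k : ℤ} {z : Plane} (hj : z ∈ G.Oms j) (hk : z ∈ G.Oms k) : j = k :=
  G.oms_injective ((G.isComponent_oms j).eq_of_mem (G.isComponent_oms k) hj hk)

lemma notMem_oms_of_mem_gams {i j : ℤ} {z : Plane} (hz : z ∈ G.Gams i) : z ∉ G.Oms j := fun h =>
  ((G.isComponent_oms j).subset h).2 (mem_iUnion.2 ⟨i, hz⟩)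

/-- A small square around a point of `Γ_i` is cut by `Γ_i` into an upper left part `P` and a lower
right part `M`, one of which lies in `Ω_i` and the other in `Ω_{i-1}`. -/
lemma exists_sides {i : ℤ} {x₀ : Plane} (hx₀ : x₀ ∈ G.Gams i) (hO : x₀ ∈ openQuadrant)
    (hΩ : x₀ ∉ closure G.Om) :
    ∃ N P M : Set Plane, N ∈ 𝓝 x₀ ∧ IsOpen N ∧ IsOpen P ∧ IsOpen M ∧ N ⊆ P ∪ M ∪ G.Gams i ∧
      (∀ x ∈ N, ∀ z ∈ P, x 0 < z 0 → z 1 < x 1 → x ∈ P) ∧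
      (∀ x ∈ N, ∀ z ∈ M, z 0 < x 0 → x 1 < z 1 → x ∈ M) ∧
      (∀ y ∈ N, ∀ z ∈ N, y ∈ G.Gams i → z ∈ G.Gams i → (z 0 = y 0 ∨ z 1 = y 1) → z = y) ∧
      (P ⊆ G.Oms i ∧ M ⊆ G.Oms (i - 1) ∨ M ⊆ G.Oms i ∧ P ⊆ G.Oms (i - 1)) := by
  obtain ⟨f, r, hr, hfc, hf, hfG⟩ := G.exists_local_graph hx₀ hO hΩ
  have hV : (openQuadrant ∩ (closure G.Om)ᶜ) ∩ (⋂ k, ⋂ (_ : x₀ ∉ G.Gams k), (G.Gams k)ᶜ) ∈ 𝓝 x₀ :=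
    inter_mem (inter_mem (isOpen_openQuadrant.mem_nhds hO)
      (isClosed_closure.isOpen_compl.mem_nhds hΩ)) G.mem_nhds_avoiding
  obtain ⟨ε, hε, hεV⟩ := Metric.mem_nhds_iff.1 hV
  set s := min r (ε / 2) with hs
  have hspos : 0 < s := by positivity
  set N : Set Plane := {z | z 0 ∈ Ioo (x₀ 0 - s) (x₀ 0 + s) ∧ z 1 ∈ Ioo (x₀ 1 - s) (x₀ 1 + s)}
    with hN
  have hc : ∀ k : Fin 2, Continuous fun z : Plane => z k := fun k => by fun_prop
  have hNo : IsOpen N := (isOpen_Ioo.preimage (hc 0)).inter (isOpen_Ioo.preimage (hc 1))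
  have hx₀N : x₀ ∈ N := by
    refine ⟨⟨?_, ?_⟩, ?_, ?_⟩ <;> linarith
  have hIoo : Ioo (x₀ 0 - s) (x₀ 0 + s) ⊆ Ioo (x₀ 0 - r) (x₀ 0 + r) :=
    Ioo_subset_Ioo (by linarith [min_le_left r (ε / 2)]) (by linarith [min_le_left r (ε / 2)])
  have hNV : N ⊆ (openQuadrant ∩ (closure G.Om)ᶜ) ∩
      (⋂ k, ⋂ (_ : x₀ ∉ G.Gams k), (G.Gams k)ᶜ) := fun z hz => hεV <| by
    rw [mem_ball_iff_norm]
    have h0 : |z 0 - x₀ 0| < s := abs_lt.2 ⟨by linarith [hz.1.1], by linarith [hz.1.2]⟩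
    have h1 : |z 1 - x₀ 1| < s := abs_lt.2 ⟨by linarith [hz.2.1], by linarith [hz.2.2]⟩
    have := norm_le_abs_add_abs (z - x₀) (show (0 : Fin 2) ≠ 1 by decide)
    simp only [PiLp.sub_apply] at this
    linarith [min_le_right r (ε / 2)]
  have hNS : ∀ z ∈ N, z ∉ G.Gams i → z ∈ (quadrant \ G.Om) \ ⋃ k, G.Gams k := by
    intro z hz hzi
    obtain ⟨⟨h1, h2⟩, h3⟩ := hNV hz
    refine ⟨⟨openQuadrant_subset_quadrant h1, fun h => h2 (subset_closure h)⟩, fun h => ?_⟩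
    obtain ⟨k, hk⟩ := mem_iUnion.1 h
    rcases eq_or_ne k i with rfl | hki
    · exact hzi hk
    · have hxk : x₀ ∉ G.Gams k := fun h' => disjoint_left.1 (G.gams_disjoint k i hki) h' hx₀
      exact mem_iInter₂.1 h3 k hxk hk
  have hfG' : ∀ z ∈ N, (z ∈ G.Gams i ↔ z 1 = f (z 0)) := fun z hz => hfG z (hIoo hz.1)
  set P : Set Plane := {z | z ∈ N ∧ f (z 0) < z 1} with hP
  set M : Set Plane := {z | z ∈ N ∧ z 1 < f (z 0)} with hM
  have hfcont : ∀ z ∈ N, Tendsto (fun w : Plane => f (w 0) - w 1) (𝓝 z) (𝓝 (f (z 0) - z 1)) := by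
    intro z hz
    have h1 : ContinuousAt f (z 0) :=
      hfc.continuousAt (isOpen_Ioo.mem_nhds (hIoo hz.1))
    exact (h1.tendsto.comp ((hc 0).tendsto z)).sub ((hc 1).tendsto z)
  have hPo : IsOpen P := isOpen_iff_mem_nhds.2 fun z hz => by
    filter_upwards [hNo.mem_nhds hz.1, (hfcont z hz.1).eventually_lt_const (sub_neg.2 hz.2)]
      with w h1 h2 using ⟨h1, sub_neg.1 h2⟩
  have hMo : IsOpen M := isOpen_iff_mem_nhds.2 fun z hz => by
    filter_upwards [hNo.mem_nhds hz.1, (hfcont z hz.1).eventually_const_lt (sub_pos.2 hz.2)]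
      with w h1 h2 using ⟨h1, sub_pos.1 h2⟩
  have hmono : ∀ z ∈ N, ∀ w ∈ N, z 0 ≤ w 0 → f (z 0) ≤ f (w 0) := fun z hz w hw h =>
    hf.monotoneOn (hIoo hz.1) (hIoo hw.1) h
  have hPS : P ⊆ (quadrant \ G.Om) \ ⋃ k, G.Gams k := fun z hz =>
    hNS z hz.1 fun h => hz.2.ne' ((hfG' z hz.1).1 h)
  have hMS : M ⊆ (quadrant \ G.Om) \ ⋃ k, G.Gams k := fun z hz =>
    hNS z hz.1 fun h => hz.2.ne ((hfG' z hz.1).1 h)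
  -- two points of a side are joined via the corner of their bounding rectangle away from the curve
  have hPpre : IsPreconnected P := by
    refine isPreconnected_of_segments fun p hp q hq => ⟨!₂[min (p 0) (q 0), max (p 1) (q 1)], ?_⟩
    have key : ∀ w ∈ P, ∀ z, z 0 ∈ Icc (min (p 0) (q 0)) (w 0) → z 1 ∈ Icc (w 1) (max (p 1) (q 1)) →
        z ∈ P := by
      intro w hw z h0 h1
      have hz : z ∈ N := ⟨⟨(lt_min hp.1.1.1 hq.1.1.1).trans_le h0.1, h0.2.trans_lt hw.1.1.2⟩,
        hw.1.2.1.trans_le h1.1, h1.2.trans_lt (max_lt hp.1.2.2 hq.1.2.2)⟩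
      exact ⟨hz, ((hmono z hz w hw.1 h0.2).trans_lt hw.2).trans_le h1.1⟩
    constructor
    · intro z hz
      have h0 := apply_mem_uIcc_of_mem_segment hz 0
      have h1 := apply_mem_uIcc_of_mem_segment hz 1
      exact key p hp z (by simpa [uIcc_of_ge (min_le_left (p 0) (q 0))] using h0)
        (by simpa [uIcc_of_le (le_max_left (p 1) (q 1))] using h1)
    · intro z hz
      have h0 := apply_mem_uIcc_of_mem_segment hz 0
      have h1 := apply_mem_uIcc_of_mem_segment hz 1
      exact key q hq z (by simpa [uIcc_of_ge (min_le_right (p 0) (q 0))] using h0)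
        (by simpa [uIcc_of_le (le_max_right (p 1) (q 1))] using h1)
  have hMpre : IsPreconnected M := by
    refine isPreconnected_of_segments fun p hp q hq => ⟨!₂[max (p 0) (q 0), min (p 1) (q 1)], ?_⟩
    have key : ∀ w ∈ M, ∀ z, z 0 ∈ Icc (w 0) (max (p 0) (q 0)) → z 1 ∈ Icc (min (p 1) (q 1)) (w 1) →
        z ∈ M := by
      intro w hw z h0 h1
      have hz : z ∈ N := ⟨⟨hw.1.1.1.trans_le h0.1, h0.2.trans_lt (max_lt hp.1.1.2 hq.1.1.2)⟩,
        (lt_min hp.1.2.1 hq.1.2.1).trans_le h1.1, h1.2.trans_lt hw.1.2.2⟩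
      exact ⟨hz, (h1.2.trans_lt hw.2).trans_le (hmono w hw.1 z hz h0.1)⟩
    constructor
    · intro z hz
      have h0 := apply_mem_uIcc_of_mem_segment hz 0
      have h1 := apply_mem_uIcc_of_mem_segment hz 1
      exact key p hp z (by simpa [uIcc_of_le (le_max_left (p 0) (q 0))] using h0)
        (by simpa [uIcc_of_ge (min_le_left (p 1) (q 1))] using h1)
    · intro z hz
      have h0 := apply_mem_uIcc_of_mem_segment hz 0
      have h1 := apply_mem_uIcc_of_mem_segment hz 1
      exact key q hq z (by simpa [uIcc_of_le (le_max_right (p 0) (q 0))] using h0)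
        (by simpa [uIcc_of_ge (min_le_right (p 1) (q 1))] using h1)
  have hcover : N ⊆ P ∪ M ∪ G.Gams i := by
    intro z hz
    rcases lt_trichotomy (z 1) (f (z 0)) with h | h | h
    · exact Or.inl (Or.inr ⟨hz, h⟩)
    · exact Or.inr ((hfG' z hz).2 h)
    · exact Or.inl (Or.inl ⟨hz, h⟩)
  -- a component having `Γ_i` on its boundary meets the square, hence contains one of the sides
  have hside : ∀ j, (j = i ∨ j = i - 1) →
      ∃ z ∈ G.Oms j, (z ∈ P ∧ P ⊆ G.Oms j) ∨ (z ∈ M ∧ M ⊆ G.Oms j) := by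
    intro j hj
    have hcl : x₀ ∈ closure (G.Oms j) := ((G.gams_frontier i j).2 hj hx₀).1
    obtain ⟨z, hzN, hzj⟩ := mem_closure_iff.1 hcl N hNo hx₀N
    refine ⟨z, hzj, ?_⟩
    rcases hcover hzN with (h | h) | h
    · exact Or.inl ⟨h, (G.isComponent_oms j).subset_of_isPreconnected hPpre hPS h hzj⟩
    · exact Or.inr ⟨h, (G.isComponent_oms j).subset_of_isPreconnected hMpre hMS h hzj⟩
    · exact absurd hzj (G.notMem_oms_of_mem_gams h)
  refine ⟨N, P, M, hNo.mem_nhds hx₀N, hNo, hPo, hMo, hcover, ?_, ?_, ?_, ?_⟩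
  · exact fun x hx z hz h0 h1 => ⟨hx, ((hmono x hx z hz.1 h0.le).trans_lt hz.2).trans h1⟩
  · exact fun x hx z hz h0 h1 => ⟨hx, (h1.trans hz.2).trans_le (hmono z hz.1 x hx h0.le)⟩
  · intro y hy z hz hyG hzG hcoord
    have hy1 := (hfG' y hy).1 hyG
    have hz1 := (hfG' z hz).1 hzG
    have h0 : z 0 = y 0 := hcoord.elim id fun h =>
      hf.injOn (hIoo hz.1) (hIoo hy.1) (by rw [← hy1, ← hz1, h])
    have h1 : z 1 = y 1 := by rw [hy1, hz1, h0]
    ext k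
    fin_cases k
    · exact h0
    · exact h1
  · obtain ⟨z, hz, ⟨hzP, hPi⟩ | ⟨hzM, hMi⟩⟩ := hside i (Or.inl rfl) <;>
    obtain ⟨w, hw, ⟨hwP, hPi'⟩ | ⟨hwM, hMi'⟩⟩ := hside (i - 1) (Or.inr rfl)
    · have := G.eq_of_mem_oms (hPi hzP) (hPi' hzP)
      omega
    · exact Or.inl ⟨hPi, hMi'⟩
    · exact Or.inr ⟨hMi, hPi'⟩
    · have := G.eq_of_mem_oms (hMi hzM) (hMi' hzM)
      omega

end CurveSystem

/-! ### Admissibility of the points off the closure of the lower region -/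

lemma isAdmissible_of_continuousAt {μ σ : Plane → ℝ} {x₀ : Plane} (hμ : ContinuousAt μ x₀)
    (hσ : ∀ᶠ x in 𝓝 x₀, ContinuousAt (fun x => σ x ^ 2) x) : IsAdmissible μ σ x₀ := by
  refine ⟨⟨1, Or.inr rfl, fun τ hτ => ?_⟩, ?_⟩
  · have h1 := Metric.continuousAt_iff'.1 hμ (τ / 2) (half_pos hτ)
    have h2 := Metric.continuousAt_iff'.1 hσ.self_of_nhds (τ / 2) (half_pos hτ)
    refine ⟨_, h1.and h2, fun x hx z hz _ _ => ?_⟩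
    have a1 := abs_lt.1 hx.1
    have a2 := abs_lt.1 hz.1
    have a3 := abs_lt.1 hx.2
    have a4 := abs_lt.1 hz.2
    constructor <;> linarith [a1.2, a2.1, a3.2, a4.1]
  · filter_upwards [hσ.eventually_nhds] with y hy
    exact hy.mono fun z hz _ _ => hz

/-- Let `g` have limits `α ≤ β` at `x₀` from two sets `A` and `B`, and let it equal the larger of
its one-sided limits on their common boundary `C`. Then near `x₀` the function `g` does not
increase by more than `τ` on passing from `z` to `x`, unless this leads out of `A`. -/
lemma exists_nhds_le_add_of_jump {g : Plane → ℝ} {A B C N : Set Plane} {x₀ : Plane} {α β : ℝ}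
    (hN : N ∈ 𝓝 x₀) (hNABC : N ⊆ A ∪ B ∪ C) (hαβ : α ≤ β) (hA : Tendsto g (𝓝[A] x₀) (𝓝 α))
    (hB : Tendsto g (𝓝[B] x₀) (𝓝 β)) (hCA : C ⊆ closure A) (hCB : C ⊆ closure B)
    (hC : ∀ y ∈ C, ∃ a b, Tendsto g (𝓝[A] y) (𝓝 a) ∧ Tendsto g (𝓝[B] y) (𝓝 b) ∧ g y = max a b)
    {τ : ℝ} (hτ : 0 < τ) :
    ∃ W ∈ 𝓝 x₀, ∀ x ∈ W, ∀ z ∈ W, (z ∈ A → x ∈ A) → g x ≤ g z + τ := by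
  have h1 := eventually_nhdsWithin_iff.1 (Metric.tendsto_nhds.1 hA (τ / 2) (half_pos hτ))
  have h2 := eventually_nhdsWithin_iff.1 (Metric.tendsto_nhds.1 hB (τ / 2) (half_pos hτ))
  obtain ⟨W, hWsub, hWo, hx₀W⟩ := mem_nhds_iff.1 ((h1.and h2).and hN)
  have hWA : ∀ y ∈ W, y ∈ A → α - τ / 2 ≤ g y ∧ g y ≤ α + τ / 2 := fun y hy hyA => by
    have := abs_lt.1 ((hWsub hy).1.1 hyA)
    constructor <;> linarith [this.1, this.2]
  have hWB : ∀ y ∈ W, y ∈ B → β - τ / 2 ≤ g y ∧ g y ≤ β + τ / 2 := fun y hy hyB => by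
    have := abs_lt.1 ((hWsub hy).1.2 hyB)
    constructor <;> linarith [this.1, this.2]
  have hWnA : ∀ y ∈ W, y ∉ A → β - τ / 2 ≤ g y ∧ g y ≤ β + τ / 2 := by
    intro y hy hyA
    rcases (hNABC (hWsub hy).2) with (h | h) | h
    · exact absurd h hyA
    · exact hWB y hy h
    · obtain ⟨a, b, ha, hb, hab⟩ := hC y h
      have : (𝓝[A] y).NeBot := mem_closure_iff_nhdsWithin_neBot.1 (hCA h)
      have : (𝓝[B] y).NeBot := mem_closure_iff_nhdsWithin_neBot.1 (hCB h)
      have hyW : W ∈ 𝓝 y := hWo.mem_nhds hy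
      have eA : ∀ᶠ w in 𝓝[A] y, g w ≤ α + τ / 2 := by
        filter_upwards [mem_nhdsWithin_of_mem_nhds hyW, self_mem_nhdsWithin] with w hw hwA
          using (hWA w hw hwA).2
      have eB : ∀ᶠ w in 𝓝[B] y, β - τ / 2 ≤ g w ∧ g w ≤ β + τ / 2 := by
        filter_upwards [mem_nhdsWithin_of_mem_nhds hyW, self_mem_nhdsWithin] with w hw hwB
          using hWB w hw hwB
      have ha' := le_of_tendsto ha eA
      have hb' := le_of_tendsto hb (eB.mono fun _ h => h.2)
      have hb'' := ge_of_tendsto hb (eB.mono fun _ h => h.1)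
      rw [hab]
      exact ⟨hb''.trans (le_max_right _ _), max_le (by linarith) hb'⟩
  refine ⟨W, hWo.mem_nhds hx₀W, fun x hx z hz hxz => ?_⟩
  by_cases hzA : z ∈ A
  · linarith [(hWA x hx (hxz hzA)).2, (hWA z hz hzA).1]
  · have := (hWnA z hz hzA).1
    by_cases hxA : x ∈ A
    · linarith [(hWA x hx hxA).2]
    · linarith [(hWnA x hx hxA).2]

lemma HypF1.continuousAt {G : CurveSystem} {g : Plane → ℝ} (hg : HypF1 G g) {j : ℤ} {z : Plane}
    {U : Set Plane} (hU : IsOpen U) (hUj : U ⊆ G.Oms j) (hz : z ∈ U) : ContinuousAt g z := by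
  obtain ⟨C, hC⟩ := hg.lipschitz
  exact ((hC j).continuousOn.mono hUj).continuousAt (hU.mem_nhds hz)

/-- Inside `Ω` both coefficients vanish. -/
lemma isAdmissible_of_om_mem_nhds {G : CurveSystem} {μ σ : Plane → ℝ} (hμ : HypF1 G μ)
    (hσ : HypF1 G (fun x => σ x ^ 2)) {x₀ : Plane} (h : G.Om ∈ 𝓝 x₀) : IsAdmissible μ σ x₀ := by
  refine isAdmissible_of_continuousAt ?_ ?_
  · exact continuousAt_const.congr (f := fun _ => (0 : ℝ))
      (mem_of_superset h fun x hx => (hμ.zero_on x hx).symm)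
  · filter_upwards [eventually_mem_nhds_iff.2 h] with y hy
    exact continuousAt_const.congr (f := fun _ => (0 : ℝ))
      (mem_of_superset hy fun x hx => (hσ.zero_on x hx).symm)

/-- Away from all the curves the coefficients are continuous. -/
lemma isAdmissible_of_notMem_gams {G : CurveSystem} {μ σ : Plane → ℝ} (hμ : HypF1 G μ)
    (hσ : HypF1 G (fun x => σ x ^ 2)) {x₀ : Plane} (hO : x₀ ∈ openQuadrant)
    (hΩ : x₀ ∉ closure G.Om) (hΓ : ∀ i, x₀ ∉ G.Gams i) : IsAdmissible μ σ x₀ := by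
  obtain ⟨r, hr, hrV⟩ := Metric.mem_nhds_iff.1 (inter_mem
    (inter_mem (isOpen_openQuadrant.mem_nhds hO) (isClosed_closure.isOpen_compl.mem_nhds hΩ))
    G.mem_nhds_avoiding)
  have hS : Metric.ball x₀ r ⊆ (quadrant \ G.Om) \ ⋃ k, G.Gams k := fun z hz => by
    obtain ⟨⟨h1, h2⟩, h3⟩ := hrV hz
    refine ⟨⟨openQuadrant_subset_quadrant h1, fun h => h2 (subset_closure h)⟩, fun h => ?_⟩
    obtain ⟨k, hk⟩ := mem_iUnion.1 h
    exact mem_iInter₂.1 h3 k (hΓ k) hk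
  have hx₀ := Metric.mem_ball_self (x := x₀) hr
  obtain ⟨j, hj⟩ := (G.oms_component _).1 ⟨x₀, hS hx₀, rfl⟩
  have hball : Metric.ball x₀ r ⊆ G.Oms j := hj ▸
    (convex_ball x₀ r).isPreconnected.subset_connectedComponentIn hx₀ hS
  refine isAdmissible_of_continuousAt (hμ.continuousAt Metric.isOpen_ball hball hx₀) ?_
  filter_upwards [Metric.ball_mem_nhds x₀ hr] with y hy
  exact hσ.continuousAt Metric.isOpen_ball hball hy

/-- The jump condition at a point, sorted by which of the two regions carries the smaller
limits. -/
lemma SimultaneousF3.exists_sorted {G : CurveSystem} {g h : Plane → ℝ}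
    (hF3 : SimultaneousF3 G g h) {i : ℤ} {x : Plane} (hx : x ∈ G.Gams i) :
    ∃ lo hi : ℤ, (lo = i - 1 ∧ hi = i ∨ lo = i ∧ hi = i - 1) ∧
      (∃ a b, a ≤ b ∧ Tendsto g (𝓝[G.Oms lo] x) (𝓝 a) ∧ Tendsto g (𝓝[G.Oms hi] x) (𝓝 b)) ∧
      ∃ a b, a ≤ b ∧ Tendsto h (𝓝[G.Oms lo] x) (𝓝 a) ∧ Tendsto h (𝓝[G.Oms hi] x) (𝓝 b) := by
  obtain ⟨ε, hε, ζ, hζ, hjump⟩ := hF3 i x hx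
  obtain ⟨⟨a, b, ha, hb, hab⟩, a', b', ha', hb', hab'⟩ := hjump x ⟨Metric.mem_ball_self hε, hx⟩
  rcases hζ with rfl | rfl
  · exact ⟨i - 1, i, Or.inl ⟨rfl, rfl⟩, ⟨a, b, by linarith, ha, hb⟩, a', b', by linarith, ha', hb'⟩
  · exact ⟨i, i - 1, Or.inr ⟨rfl, rfl⟩, ⟨b, a, by linarith, hb, ha⟩, b', a', by linarith, hb', ha'⟩

lemma exists_limits_of_mem_gams {G : CurveSystem} {g : Plane → ℝ} {i : ℤ}
    (hlim : ∀ y ∈ G.Gams i, ∃ ζ, JumpSign G g i ζ y) (hval : LargerLimitOnCurves G g) {lo hi : ℤ}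
    (hlohi : lo = i - 1 ∧ hi = i ∨ lo = i ∧ hi = i - 1) :
    ∀ y ∈ G.Gams i, ∃ a b, Tendsto g (𝓝[G.Oms lo] y) (𝓝 a) ∧
      Tendsto g (𝓝[G.Oms hi] y) (𝓝 b) ∧ g y = max a b := by
  intro y hy
  obtain ⟨ζ, a, b, ha, hb, -⟩ := hlim y hy
  have := hval i y hy a b ha hb
  rcases hlohi with ⟨rfl, rfl⟩ | ⟨rfl, rfl⟩
  · exact ⟨a, b, ha, hb, this⟩
  · exact ⟨b, a, hb, ha, by rw [this, max_comm]⟩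

/-- On an increasing curve the direction of the shift points into the region with the smaller
limits, which a step to the upper left (or to the lower right) does not leave. -/
lemma isAdmissible_of_mem_gams {G : CurveSystem} {μ σ : Plane → ℝ}
    (hσ : HypF1 G (fun x => σ x ^ 2)) (hF3 : SimultaneousF3 G μ (fun x => σ x ^ 2))
    (hμΓ : LargerLimitOnCurves G μ) (hσΓ : LargerLimitOnCurves G (fun x => σ x ^ 2)) {i : ℤ}
    {x₀ : Plane} (hO : x₀ ∈ openQuadrant) (hΩ : x₀ ∉ closure G.Om) (hx₀ : x₀ ∈ G.Gams i) :
    IsAdmissible μ σ x₀ := by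
  obtain ⟨N, P, M, hN, hNo, hPo, hMo, hcover, hPcone, hMcone, hcoord, hsides⟩ :=
    G.exists_sides hx₀ hO hΩ
  obtain ⟨lo, hi, hlohi, ⟨a, b, hab, ha, hb⟩, a', b', hab', ha', hb'⟩ := hF3.exists_sorted hx₀
  have hsides' : (P ⊆ G.Oms lo ∧ M ⊆ G.Oms hi) ∨ (M ⊆ G.Oms lo ∧ P ⊆ G.Oms hi) := by
    rcases hlohi with ⟨rfl, rfl⟩ | ⟨rfl, rfl⟩ <;> tauto
  have hne : lo ≠ hi := by rcases hlohi with ⟨rfl, rfl⟩ | ⟨rfl, rfl⟩ <;> omega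
  have hcover' : N ⊆ G.Oms lo ∪ G.Oms hi ∪ G.Gams i := by
    intro z hz
    rcases hcover hz with (h | h) | h
    · rcases hsides' with ⟨h1, -⟩ | ⟨-, h1⟩
      exacts [Or.inl (Or.inl (h1 h)), Or.inl (Or.inr (h1 h))]
    · rcases hsides' with ⟨-, h1⟩ | ⟨h1, -⟩
      exacts [Or.inl (Or.inr (h1 h)), Or.inl (Or.inl (h1 h))]
    · exact Or.inr h
  have hcl : ∀ j, (j = lo ∨ j = hi) → G.Gams i ⊆ closure (G.Oms j) := fun j hj =>
    ((G.gams_frontier i j).2 (by omega)).trans frontier_subset_closure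
  have hdir : ∃ ζ : ℝ, (ζ = -1 ∨ ζ = 1) ∧ ∀ x ∈ N, ∀ z ∈ N, ζ * (x 0 - z 0) < 0 →
      0 < ζ * (x 1 - z 1) → z ∈ G.Oms lo → x ∈ G.Oms lo := by
    rcases hsides' with ⟨h1, h2⟩ | ⟨h1, h2⟩
    · refine ⟨1, Or.inr rfl, fun x hx z hz h0 h1' hzlo => ?_⟩
      rcases hcover hz with (h | h) | h
      · exact h1 (hPcone x hx z h (by linarith) (by linarith))
      · exact absurd (G.eq_of_mem_oms hzlo (h2 h)) hne
      · exact absurd hzlo (G.notMem_oms_of_mem_gams h)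
    · refine ⟨-1, Or.inl rfl, fun x hx z hz h0 h1' hzlo => ?_⟩
      rcases hcover hz with (h | h) | h
      · exact absurd (G.eq_of_mem_oms hzlo (h2 h)) hne
      · exact h1 (hMcone x hx z h (by linarith) (by linarith))
      · exact absurd hzlo (G.notMem_oms_of_mem_gams h)
  have hlimμ : ∀ y ∈ G.Gams i, ∃ ζ, JumpSign G μ i ζ y := fun y hy => by
    obtain ⟨ε, hε, ζ, -, h⟩ := hF3 i y hy
    exact ⟨ζ, (h y ⟨Metric.mem_ball_self hε, hy⟩).1⟩
  have hlimσ : ∀ y ∈ G.Gams i, ∃ ζ, JumpSign G (fun x => σ x ^ 2) i ζ y := fun y hy => by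
    obtain ⟨ε, hε, ζ, -, h⟩ := hF3 i y hy
    exact ⟨ζ, (h y ⟨Metric.mem_ball_self hε, hy⟩).2⟩
  obtain ⟨ζ, hζ, hζN⟩ := hdir
  refine ⟨⟨ζ, hζ, fun τ hτ => ?_⟩, ?_⟩
  · obtain ⟨W₁, hW₁, h1⟩ := exists_nhds_le_add_of_jump hN hcover' hab ha hb
      (hcl lo (Or.inl rfl)) (hcl hi (Or.inr rfl)) (exists_limits_of_mem_gams hlimμ hμΓ hlohi) hτ
    obtain ⟨W₂, hW₂, h2⟩ := exists_nhds_le_add_of_jump hN hcover' hab' ha' hb'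
      (hcl lo (Or.inl rfl)) (hcl hi (Or.inr rfl)) (exists_limits_of_mem_gams hlimσ hσΓ hlohi) hτ
    refine ⟨N ∩ (W₁ ∩ W₂), inter_mem hN (inter_mem hW₁ hW₂), fun x hx z hz h0 h3 => ?_⟩
    have := hζN x hx.1 z hz.1 h0 h3
    exact ⟨h1 x hx.2.1 z hz.2.1 this, h2 x hx.2.2 z hz.2.2 this⟩
  · have hcont : ∀ z ∈ P ∪ M, ContinuousAt (fun x => σ x ^ 2) z := by
      rintro z (h | h)
      · rcases hsides' with ⟨h1, -⟩ | ⟨-, h1⟩ <;> exact hσ.continuousAt hPo h1 h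
      · rcases hsides' with ⟨-, h1⟩ | ⟨h1, -⟩ <;> exact hσ.continuousAt hMo h1 h
    filter_upwards [hN] with y hy
    rcases hcover hy with h | h
    · filter_upwards [(hPo.union hMo).mem_nhds h] with z hz _ _ using hcont z hz
    · filter_upwards [hNo.mem_nhds hy] with z hz hzy hzc
      rcases hcover hz with h' | h'
      · exact hcont z h'
      · exact absurd (hcoord y hy z hz h h' hzc) hzy

/-! ### Comparison -/

/-- Comparison on `Ω`, by boxes contained in it. -/
lemma le_on_om {G : CurveSystem} {μ σ u v : Plane → ℝ}
    (hu : IsViscositySubsolution openQuadrant (hamiltonian μ σ) u)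
    (hv : IsViscositySupersolution openQuadrant (hamiltonian μ σ) v)
    (huc : ContinuousOn u quadrant) (hvc : ContinuousOn v quadrant) (hvm : IsMonotone v)
    (hzero : {x ∈ openQuadrant | σ x = 0} ⊆ {x ∈ openQuadrant | μ x = 0})
    (hμ : HypF1 G μ) (hσ : HypF1 G (fun x => σ x ^ 2)) (hb : ∀ x ∈ axes, u x ≤ v x)
    {z : Plane} (hz : z ∈ G.Om) : u z ≤ v z := by
  have hzq : z ∈ quadrant := (G.om_subset hz).1
  by_cases hzO : z ∈ openQuadrant
  swap
  · refine hb z ⟨hzq, ?_⟩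
    by_contra! h
    exact hzO ⟨lt_of_le_of_ne hzq.1 h.1.symm, lt_of_le_of_ne hzq.2 h.2.symm⟩
  have hlim : Tendsto (fun t : ℝ => z - t • (!₂[1, 1] : Plane)) (𝓝[>] 0) (𝓝 z) := by
    have h : Tendsto (fun t : ℝ => z - t • (!₂[1, 1] : Plane)) (𝓝 0)
        (𝓝 (z - (0 : ℝ) • (!₂[1, 1] : Plane))) := by
      apply Continuous.tendsto; fun_prop
    rw [zero_smul, sub_zero] at h
    exact h.mono_left nhdsWithin_le_nhds
  have hq := quadrant_mem_nhds hzO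
  refine le_of_tendsto_of_tendsto ((huc.continuousAt hq).tendsto.comp hlim)
    ((hvc.continuousAt hq).tendsto.comp hlim) ?_
  filter_upwards [hlim.eventually hq, self_mem_nhdsWithin] with t ht htpos
  have htpos' : 0 < t := htpos
  refine le_on_box (R := z) hu hv huc hvc hvm hzero (fun x hx hxz => ?_) ht ?_
  · by_cases hxa : x 0 = 0 ∨ x 1 = 0
    · exact Or.inl (hb x ⟨hx, hxa⟩)
    · push Not at hxa
      have hxO : x ∈ openQuadrant :=
        ⟨lt_of_le_of_ne hx.1 hxa.1.symm, lt_of_le_of_ne hx.2 hxa.2.symm⟩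
      refine Or.inr ⟨hxO, fun hxz' => isAdmissible_of_om_mem_nhds hμ hσ ?_⟩
      have c0 : Continuous fun z : Plane => z 0 := by fun_prop
      have c1 : Continuous fun z : Plane => z 1 := by fun_prop
      filter_upwards [quadrant_mem_nhds hxO, (c0.tendsto x).eventually_lt_const (hxz' 0),
        (c1.tendsto x).eventually_lt_const (hxz' 1)] with y h1 h2 h3
      exact G.mem_om_of_le hz h1 (Fin.forall_fin_two.2 ⟨h2.le, h3.le⟩)
  · rw [Fin.forall_fin_two]
    constructor <;> simpa using htpos'

/-- The comparison principle, with the order of `u` and `v` given on the axes. -/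
lemma le_on_quadrant {G : CurveSystem} {μ σ u v : Plane → ℝ}
    (hu : IsViscositySubsolution openQuadrant (hamiltonian μ σ) u)
    (hv : IsViscositySupersolution openQuadrant (hamiltonian μ σ) v)
    (huc : ContinuousOn u quadrant) (hvc : ContinuousOn v quadrant) (hvm : IsMonotone v)
    (hzero : {x ∈ openQuadrant | σ x = 0} ⊆ {x ∈ openQuadrant | μ x = 0})
    (hμ : HypF1 G μ) (hσ : HypF1 G (fun x => σ x ^ 2))
    (hF3 : SimultaneousF3 G μ (fun x => σ x ^ 2)) (hμΓ : LargerLimitOnCurves G μ)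
    (hσΓ : LargerLimitOnCurves G (fun x => σ x ^ 2)) (hb : ∀ x ∈ axes, u x ≤ v x)
    {x : Plane} (hx : x ∈ quadrant) : u x ≤ v x := by
  have hcl : closure G.Om ⊆ {x ∈ quadrant | u x ≤ v x} :=
    closure_minimal (fun z hz => ⟨(G.om_subset hz).1,
      le_on_om hu hv huc hvc hvm hzero hμ hσ hb hz⟩) (isClosed_quadrant.isClosed_le huc hvc)
  refine le_on_box (R := !₂[x 0 + 1, x 1 + 1]) hu hv huc hvc hvm hzero (fun y hy _ => ?_) hx ?_
  · by_cases hya : y 0 = 0 ∨ y 1 = 0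
    · exact Or.inl (hb y ⟨hy, hya⟩)
    by_cases hyΩ : y ∈ closure G.Om
    · exact Or.inl (hcl hyΩ).2
    push Not at hya
    have hyO : y ∈ openQuadrant :=
      ⟨lt_of_le_of_ne hy.1 hya.1.symm, lt_of_le_of_ne hy.2 hya.2.symm⟩
    refine Or.inr ⟨hyO, fun _ => ?_⟩
    by_cases hyΓ : ∃ i, y ∈ G.Gams i
    · obtain ⟨i, hi⟩ := hyΓ
      exact isAdmissible_of_mem_gams hσ hF3 hμΓ hσΓ hyO hyΩ hi
    · exact isAdmissible_of_notMem_gams hμ hσ hyO hyΩ (not_exists.1 hyΓ)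
  · rw [Fin.forall_fin_two]
    simp

end DLPP

theorem mainTheorem2 (G : DLPP.CurveSystem) (μ σ μs : DLPP.Plane → ℝ)
    (hσ : ∀ x ∈ DLPP.quadrant, 0 ≤ σ x)
    (hF1μ : DLPP.HypF1 G μ) (hF1σ : DLPP.HypF1 G (fun x => σ x ^ 2))
    (hF3 : DLPP.SimultaneousF3 G μ (fun x => σ x ^ 2))
    (hμΓ : DLPP.LargerLimitOnCurves G μ)
    (hσΓ : DLPP.LargerLimitOnCurves G (fun x => σ x ^ 2))
    (hzero : {x ∈ DLPP.openQuadrant | σ x = 0} ⊆ {x ∈ DLPP.openQuadrant | μ x = 0})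
    (hF2 : DLPP.HypF2 μs) :
    (∀ u v : DLPP.Plane → ℝ,
      ContinuousOn u DLPP.quadrant → ContinuousOn v DLPP.quadrant →
      DLPP.IsViscositySubsolution DLPP.openQuadrant (DLPP.hamiltonian μ σ) u →
      DLPP.IsViscositySupersolution DLPP.openQuadrant (DLPP.hamiltonian μ σ) v →
      DLPP.IsMonotone v →
      (∀ x ∈ DLPP.axes, u x ≤ DLPP.boundaryData μ μs x ∧ DLPP.boundaryData μ μs x ≤ v x) →
      ∀ x ∈ DLPP.quadrant, u x ≤ v x) ∧
    (∀ U V : DLPP.Plane → ℝ,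
      DLPP.IsMonotoneSolution μ σ μs U → DLPP.IsMonotoneSolution μ σ μs V →
      ∀ x ∈ DLPP.quadrant, U x = V x) := by
  have hcomp : ∀ u v : DLPP.Plane → ℝ,
      ContinuousOn u DLPP.quadrant → ContinuousOn v DLPP.quadrant →
      DLPP.IsViscositySubsolution DLPP.openQuadrant (DLPP.hamiltonian μ σ) u →
      DLPP.IsViscositySupersolution DLPP.openQuadrant (DLPP.hamiltonian μ σ) v →
      DLPP.IsMonotone v →
      (∀ x ∈ DLPP.axes, u x ≤ DLPP.boundaryData μ μs x ∧ DLPP.boundaryData μ μs x ≤ v x) →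
      ∀ x ∈ DLPP.quadrant, u x ≤ v x :=
    fun u v huc hvc hu hv hvm hb x hx =>
      DLPP.le_on_quadrant hu hv huc hvc hvm hzero hF1μ hF1σ hF3 hμΓ hσΓ
        (fun y hy => (hb y hy).1.trans (hb y hy).2) hx
  refine ⟨hcomp, fun U V hU hV x hx => le_antisymm ?_ ?_⟩
  · exact hcomp U V hU.continuousOn hV.continuousOn hU.sub hV.super hV.monotone
      (fun y hy => ⟨(hU.boundary y hy).le, (hV.boundary y hy).ge⟩) x hx
  · exact hcomp V U hV.continuousOn hU.continuousOn hV.sub hU.super hU.monotone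
      (fun y hy => ⟨(hV.boundary y hy).le, (hU.boundary y hy).ge⟩) x hx
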